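/- Conventions. Languages are relational: groups are structures $(G,\cdot)$ and fields are structures $(K,+,\cdot)$, with the operations given by their graphs. For a field $F$ let $H(F)$ be the Heisenberg group, the subgroup of $GL_3(F)$ of all matrices $$h(a,b,c)=\begin{pmatrix}1&a&c\\0&1&b\\0&0&1\end{pmatrix}\qquad(a,b,c\in F).$$ A copy of a structure $\mathcal B$ is a structure isomorphic to $\mathcal B$ whose universe is a subset of $\omega$; it is identified with the characteristic function of (the set of Gödel numbers of) its atomic diagram, and a function between subsets of $\omega$ is identified with the characteristic function of its graph. A pair of Turing operators $\Phi,\Psi$ is a computable functor from $\mathcal B$ to $\mathcal A$ if $\Phi$ takes copies of $\mathcal B$ to copies of $\mathcal A$; $\Psi$ takes each triple $(\mathcal B_1,p,\mathcal B_2)$, where $\mathcal B_1,\mathcal B_2$ are copies of $\mathcal B$ and $p$ is an isomorphism from $\mathcal B_1$ onto $\mathcal B_2$, to an isomorphism from $\Phi(\mathcal B_1)$ onto $\Phi(\mathcal B_2)$; and $\Psi$ preserves identity and composition. For a non-commuting pair $(u,v)$ in a copy $G$ of $H(F)$ (or in $H(F)$ itself), with $[x,y]=x^{-1}y^{-1}xy$,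 let $F_{(u,v)}=(Z(G),\oplus,\otimes_{(u,v)})$, where $\oplus$ is the group operation and $x\otimes_{(u,v)}y=z$ holds iff there are $x',y'\in G$ with $[x',u]=[y',v]=1$, $[x',v]=x$, $[u,y']=y$ and $[x',y']=z$. For $u=h(u_1,u_2,u_3)$ and $v=h(v_1,v_2,v_3)$ in $H(F)$ let $\Delta_{(u,v)}=u_1v_2-v_1u_2$ and let $g_{(u,v)}\colon F\to F_{(u,v)}$ be the function $\alpha\mapsto h(0,0,\alpha\Delta_{(u,v)})$. **Proposition.** There are Turing operators $\Phi,\Psi$ and a finitary existential formula $\psi(u,v,u',v',x,y)$ in the language of groups such that, for all fields $F$: 1. $\Phi,\Psi$ form a computable functor from $H(F)$ to $F$. 2. There are isomorphisms $f_{(u,v),(u',v')}$ from $F_{(u,v)}$ onto $F_{(u',v')}$, for all non-commuting pairs $(u,v),(u',v')$ in $H(F)$, such that $f_{(u,v),(u',v')}(g_{(u,v)}(\alpha))=g_{(u',v')}(\alpha)$ for all $\alpha\in F$, $f_{(u,v),(u,v)}$ is the identity, $f_{(u,v),(u'',v'')}=f_{(u',v'),(u'',v'')}\circ f_{(u,v),(u',v')}$,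 and, for all $x,y\in H(F)$, $H(F)\models\psi(u,v,u',v',x,y)$ iff $x\in F_{(u,v)}$ and $f_{(u,v),(u',v')}(x)=y$. 3. One can assign to each copy $G$ of $H(F)$ a non-commuting pair $(u_G,v_G)$ in $G$ such that $\Phi(G)=F_{(u_G,v_G)}$ (defined in $G$), and, for every isomorphism $p$ from a copy $G_1$ onto a copy $G_2$, $\Psi(G_1,p,G_2)$ is the function $x\mapsto f_{(p(u_{G_1}),p(v_{G_1})),(u_{G_2},v_{G_2})}(p(x))$, where the isomorphisms $f$ are carried from $H(F)$ to $G_2$ by any isomorphism from $G_2$ onto $H(F)$. -/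

import Mathlib

universe u v

namespace HeisenbergFunctor

open scoped FirstOrder

/-! ### Turing operators -/

/-- Programs for oracle computation: the usual generators of the partial recursive functions
together with one instruction `oracle` that queries the oracle. A program is a finite object
that does not depend on the oracle, so it denotes a Turing operator. -/
inductive TuringOperator : Type
  | zero : TuringOperator
  | succ : TuringOperator
  | left : TuringOperator
  | right : TuringOperator
  | oracle : TuringOperator
  | pair : TuringOperator → TuringOperator → TuringOperator
  | comp : TuringOperator → TuringOperator → TuringOperator
  | prec : TuringOperator → TuringOperator → TuringOperator
  | rfind : TuringOperator → TuringOperator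

namespace TuringOperator

/-- The partial function computed by a program with the total function `A` as oracle. -/
def eval (A : ℕ → ℕ) : TuringOperator → ℕ →. ℕ
  | zero => fun _ => Part.some 0
  | succ => fun n => Part.some (n + 1)
  | left => fun n => Part.some (Nat.unpair n).1
  | right => fun n => Part.some (Nat.unpair n).2
  | oracle => fun n => Part.some (A n)
  | pair f h => fun n => Nat.pair <$> eval A f n <*> eval A h n
  | comp f h => fun n => eval A h n >>= eval A f
  | prec f h => fun p =>
      let (a, n) := Nat.unpair p
      n.rec (eval A f a) fun y IH => do
        let i ← IH
        eval A h (Nat.pair a (Nat.pair y i))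
  | rfind f => fun a => Nat.rfind fun n => (fun m => m = 0) <$> eval A f (Nat.pair a n)

/-- With a fixed oracle `A`, the programs compute exactly the partial functions recursive
in `A`. -/
theorem exists_eval_eq_iff (A : ℕ → ℕ) (f : ℕ →. ℕ) :
    (∃ c : TuringOperator, c.eval A = f) ↔ Nat.RecursiveIn {(A : ℕ →. ℕ)} f := by
  constructor
  · rintro ⟨c, rfl⟩
    induction c with
    | zero => exact .zero
    | succ => exact .succ
    | left => exact .left
    | right => exact .right
    | oracle => exact .oracle _ rfl
    | pair f h hf hh => exact .pair hf hh
    | comp f h hf hh => exact .comp hf hh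
    | prec f h hf hh => exact .prec hf hh
    | rfind f hf => exact .rfind hf
  · intro h
    induction h with
    | zero => exact ⟨zero, rfl⟩
    | succ => exact ⟨succ, rfl⟩
    | left => exact ⟨left, rfl⟩
    | right => exact ⟨right, rfl⟩
    | oracle g hg => obtain rfl := hg; exact ⟨oracle, rfl⟩
    | pair _ _ hf hh =>
      obtain ⟨c, rfl⟩ := hf; obtain ⟨d, rfl⟩ := hh; exact ⟨pair c d, rfl⟩
    | comp _ _ hf hh =>
      obtain ⟨c, rfl⟩ := hf; obtain ⟨d, rfl⟩ := hh; exact ⟨comp c d, rfl⟩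
    | prec _ _ hf hh =>
      obtain ⟨c, rfl⟩ := hf; obtain ⟨d, rfl⟩ := hh; exact ⟨prec c d, rfl⟩
    | rfind _ hf => obtain ⟨c, rfl⟩ := hf; exact ⟨rfind c, rfl⟩

/-- The operator takes the total function `A` to the total function `B`. -/
def Takes (c : TuringOperator) (A B : ℕ → ℕ) : Prop :=
  ∀ n, c.eval A n = Part.some (B n)

end TuringOperator

/-- The characteristic function of a set of natural numbers. -/
noncomputable def charFun (S : Set ℕ) : ℕ → ℕ :=
  S.indicator fun _ => 1

/-- Three oracles presented as one. -/
def join₃ (A B C : ℕ → ℕ) (n : ℕ) : ℕ :=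
  if n % 3 = 0 then A (n / 3) else if n % 3 = 1 then B (n / 3) else C (n / 3)

/-! ### Structures with universe a subset of `ω`, and their atomic diagrams -/

/-- A structure whose universe is a subset of `ω`. -/
structure OmegaStructure (L : FirstOrder.Language.{0, 0}) where
  univ : Set ℕ
  str : L.Structure univ

instance {L : FirstOrder.Language.{0, 0}} (M : OmegaStructure L) : L.Structure M.univ := M.str

/-- `G` is a copy of `B`: a structure with universe a subset of `ω` that is isomorphic to `B`. -/
def OmegaStructure.IsCopy {L : FirstOrder.Language.{0, 0}} (G : OmegaStructure L)
    (B : Type u) [L.Structure B] : Prop :=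
  Nonempty (G.univ ≃[L] B)

/-- Atomic sentences of a relational language with natural numbers as names of elements. -/
inductive AtomicSentence (L : FirstOrder.Language.{0, 0}) : Type
  | eq (a b : ℕ) : AtomicSentence L
  | rel {n : ℕ} (R : L.Relations n) (a : Fin n → ℕ) : AtomicSentence L

namespace AtomicSentence

variable {L : FirstOrder.Language.{0, 0}}

/-- All elements named in the sentence belong to the universe of `M`. -/
def NamesIn (M : OmegaStructure L) : AtomicSentence L → Prop
  | eq a b => a ∈ M.univ ∧ b ∈ M.univ
  | rel _ a => ∀ i, a i ∈ M.univ

/-- All elements named in the sentence belong to the universe of `M`, and it is true in `M`. -/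
def TrueIn (M : OmegaStructure L) : AtomicSentence L → Prop
  | eq a b => a ∈ M.univ ∧ b ∈ M.univ ∧ a = b
  | rel R a => ∃ h : ∀ i, a i ∈ M.univ,
      FirstOrder.Language.Structure.RelMap R (fun i => (⟨a i, h i⟩ : M.univ))

/-- Gödel numbers of atomic sentences. -/
def godel [∀ n, Encodable (L.Relations n)] : AtomicSentence L → ℕ
  | eq a b => Nat.pair 0 (Nat.pair a b)
  | @rel _ n R a =>
      Nat.pair 1 (Nat.pair n (Nat.pair (Encodable.encode R) (Encodable.encode (List.ofFn a))))

end AtomicSentence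

/-- The atomic diagram of a structure, as a set of Gödel numbers: the atomic sentences (tagged
`0`) and the negations of atomic sentences (tagged `1`) that are true in the structure. -/
def atomicDiagram {L : FirstOrder.Language.{0, 0}} [L.IsRelational] [∀ n, Encodable (L.Relations n)]
    (M : OmegaStructure L) : Set ℕ :=
  {k | ∃ φ : AtomicSentence L,
    (φ.TrueIn M ∧ k = Nat.pair 0 φ.godel) ∨
    (φ.NamesIn M ∧ ¬ φ.TrueIn M ∧ k = Nat.pair 1 φ.godel)}

/-- The graph of a function between subsets of `ω`, as a set of coded pairs. -/
def graphCode {X Y : Set ℕ} (p : X → Y) : Set ℕ :=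
  {k | ∃ x : X, k = Nat.pair x (p x)}

/-! ### Computable functors -/

section Functor

variable {L : FirstOrder.Language.{0, 0}} [L.IsRelational] [∀ n, Encodable (L.Relations n)]

/-- A structure identified with the characteristic function of its atomic diagram. -/
noncomputable def structureCode (M : OmegaStructure L) : ℕ → ℕ :=
  charFun (atomicDiagram M)

/-- A map between structures identified with the characteristic function of its graph. -/
noncomputable def mapCode {M N : OmegaStructure L} (p : M.univ ≃[L] N.univ) : ℕ → ℕ :=
  charFun (graphCode p)

/-- A triple `(G₁, p, G₂)` identified with a function on `ω`. -/
noncomputable def tripleCode {G₁ G₂ : OmegaStructure L} (p : G₁.univ ≃[L] G₂.univ) : ℕ → ℕ :=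
  join₃ (structureCode G₁) (mapCode p) (structureCode G₂)

end Functor

/-- The Turing operators `Φ, Ψ` form a computable functor from `B` to `A`. (A structure with
universe a subset of `ω` is determined by its atomic diagram, so `K` in the clauses below is
the structure `Φ(G)`.) -/
structure IsComputableFunctor (L L' : FirstOrder.Language.{0, 0})
    [L.IsRelational] [∀ n, Encodable (L.Relations n)]
    [L'.IsRelational] [∀ n, Encodable (L'.Relations n)]
    (Φ Ψ : TuringOperator) (B : Type u) [L.Structure B] (A : Type v) [L'.Structure A] : Prop where
  /-- `Φ` takes copies of `B` to copies of `A`. -/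
  obj : ∀ G : OmegaStructure L, G.IsCopy B →
    ∃ K : OmegaStructure L', K.IsCopy A ∧ Φ.Takes (structureCode G) (structureCode K)
  /-- `Ψ` takes `(G₁, p, G₂)`, where `p` is an isomorphism from `G₁` onto `G₂`, to an
  isomorphism from `Φ(G₁)` onto `Φ(G₂)`. -/
  map : ∀ (G₁ G₂ : OmegaStructure L) (K₁ K₂ : OmegaStructure L'), G₁.IsCopy B → G₂.IsCopy B →
    Φ.Takes (structureCode G₁) (structureCode K₁) →
    Φ.Takes (structureCode G₂) (structureCode K₂) →
    ∀ p : G₁.univ ≃[L] G₂.univ, ∃ q : K₁.univ ≃[L'] K₂.univ, Ψ.Takes (tripleCode p) (mapCode q)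
  /-- `Ψ` preserves identity. -/
  map_id : ∀ (G : OmegaStructure L) (K : OmegaStructure L'), G.IsCopy B →
    Φ.Takes (structureCode G) (structureCode K) →
    Ψ.Takes (tripleCode (FirstOrder.Language.Equiv.refl L G.univ))
      (mapCode (FirstOrder.Language.Equiv.refl L' K.univ))
  /-- `Ψ` preserves composition. -/
  map_comp : ∀ (G₁ G₂ G₃ : OmegaStructure L) (K₁ K₂ K₃ : OmegaStructure L'),
    G₁.IsCopy B → G₂.IsCopy B → G₃.IsCopy B →
    Φ.Takes (structureCode G₁) (structureCode K₁) →
    Φ.Takes (structureCode G₂) (structureCode K₂) →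
    Φ.Takes (structureCode G₃) (structureCode K₃) →
    ∀ (p₁ : G₁.univ ≃[L] G₂.univ) (p₂ : G₂.univ ≃[L] G₃.univ)
      (q₁ : K₁.univ ≃[L'] K₂.univ) (q₂ : K₂.univ ≃[L'] K₃.univ),
    Ψ.Takes (tripleCode p₁) (mapCode q₁) → Ψ.Takes (tripleCode p₂) (mapCode q₂) →
    Ψ.Takes (tripleCode (p₂.comp p₁)) (mapCode (q₂.comp q₁))

/-! ### Groups and fields as relational structures -/

/-- The relation symbol for groups: the graph of multiplication. -/
inductive GroupRel : ℕ → Type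
  | mul : GroupRel 3

/-- The relation symbols for fields: the graphs of addition and of multiplication. -/
inductive FieldRel : ℕ → Type
  | add : FieldRel 3
  | mul : FieldRel 3

/-- The language of groups, with a ternary relation symbol for `x * y = z`. -/
def groupLang : FirstOrder.Language.{0, 0} := ⟨fun _ => Empty, GroupRel⟩

/-- The language of fields, with ternary relation symbols for `x + y = z` and `x * y = z`. -/
def fieldLang : FirstOrder.Language.{0, 0} := ⟨fun _ => Empty, FieldRel⟩

/-- The symbol of `groupLang`. -/
def mulSymbol : groupLang.Relations 3 := GroupRel.mul

instance : groupLang.IsRelational := fun _ => inferInstanceAs (IsEmpty Empty)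

instance : fieldLang.IsRelational := fun _ => inferInstanceAs (IsEmpty Empty)

instance : ∀ n, Encodable (groupLang.Relations n)
  | 3 => { encode := fun _ => 0, decode := fun _ => some GroupRel.mul
           encodek := by rintro ⟨⟩; rfl }
  | 0 | 1 | 2 | _ + 4 => { encode := fun _ => 0, decode := fun _ => none
                           encodek := by rintro ⟨⟩ }

instance : ∀ n, Encodable (fieldLang.Relations n)
  | 3 => { encode := fun R => match R with
             | FieldRel.add => 0
             | FieldRel.mul => 1
           decode := fun k => match k with
             | 0 => some FieldRel.add
             | 1 => some FieldRel.mul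
             | _ => none
           encodek := by rintro ⟨⟩ <;> rfl }
  | 0 | 1 | 2 | _ + 4 => { encode := fun _ => 0, decode := fun _ => none
                           encodek := by rintro ⟨⟩ }

/-- `x * y = z` in a structure for the language of groups. -/
def IsMul {G : Type u} [groupLang.Structure G] (x y z : G) : Prop :=
  FirstOrder.Language.Structure.RelMap mulSymbol ![x, y, z]

/-- A field as a structure for the language of fields. -/
instance fieldStructure (F : Type u) [Field F] : fieldLang.Structure F where
  funMap := fun f => nomatch f
  RelMap := fun R => match R with
    | FieldRel.add => fun a => a 0 + a 1 = a 2
    | FieldRel.mul => fun a => a 0 * a 1 = a 2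

/-! ### The Heisenberg group -/

section Heisenberg

variable {F : Type u} [Field F]

/-- The matrix `h(a, b, c)`. -/
def hMatrix (a b c : F) : GL (Fin 3) F where
  val := !![1, a, c; 0, 1, b; 0, 0, 1]
  inv := !![1, -a, a * b - c; 0, 1, -b; 0, 0, 1]
  val_inv := by
    ext i j
    fin_cases i <;> fin_cases j <;> simp [Matrix.mul_apply, Fin.sum_univ_three]
    ring
  inv_val := by
    ext i j
    fin_cases i <;> fin_cases j <;> simp [Matrix.mul_apply, Fin.sum_univ_three]
    ring

theorem hMatrix_mul (a b c a' b' c' : F) :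
    hMatrix a b c * hMatrix a' b' c' = hMatrix (a + a') (b + b') (c + c' + a * b') := by
  ext i j
  fin_cases i <;> fin_cases j <;>
    simp [hMatrix, Matrix.mul_apply, Fin.sum_univ_three] <;> ring

theorem hMatrix_inv (a b c : F) : (hMatrix a b c)⁻¹ = hMatrix (-a) (-b) (a * b - c) := by
  apply Units.ext
  rfl

variable (F) in
/-- The Heisenberg group: the subgroup of `GL₃(F)` of all matrices `h(a, b, c)`. -/
def heisenbergSubgroup : Subgroup (GL (Fin 3) F) where
  carrier := {x | ∃ a b c, x = hMatrix a b c}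
  mul_mem' := by
    rintro _ _ ⟨a, b, c, rfl⟩ ⟨a', b', c', rfl⟩
    exact ⟨_, _, _, hMatrix_mul a b c a' b' c'⟩
  one_mem' := by
    refine ⟨0, 0, 0, ?_⟩
    ext i j
    fin_cases i <;> fin_cases j <;> simp [hMatrix]
  inv_mem' := by
    rintro _ ⟨a, b, c, rfl⟩
    exact ⟨_, _, _, hMatrix_inv a b c⟩

variable (F) in
/-- `H(F)`, as a group. -/
abbrev Heisenberg : Type u := heisenbergSubgroup F

/-- `H(F)` as a structure for the language of groups. -/
instance heisenbergStructure : groupLang.Structure (Heisenberg F) where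
  funMap := fun f => nomatch f
  RelMap := fun R => match R with
    | GroupRel.mul => fun a => a 0 * a 1 = a 2

/-- `h(a, b, c)` as an element of `H(F)`. -/
def hElem (a b c : F) : Heisenberg F := ⟨hMatrix a b c, a, b, c, rfl⟩

/-- The determinant `Δ_(u,v) = u₁ v₂ - v₁ u₂` for `u = h(u₁, u₂, u₃)`, `v = h(v₁, v₂, v₃)`. -/
def Delta (u v : Heisenberg F) : F :=
  Matrix.det !![u.1.1 0 1, v.1.1 0 1; u.1.1 1 2, v.1.1 1 2]

/-- The commutator `[x, y] = x⁻¹ y⁻¹ x y`. -/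
def comm (x y : Heisenberg F) : Heisenberg F := x⁻¹ * y⁻¹ * x * y

theorem hElem_mem_center (c : F) : hElem 0 0 c ∈ Subgroup.center (Heisenberg F) := by
  rw [Subgroup.mem_center_iff]
  rintro ⟨_, a', b', c', rfl⟩
  apply Subtype.ext
  change hMatrix a' b' c' * hMatrix 0 0 c = hMatrix 0 0 c * hMatrix a' b' c'
  rw [hMatrix_mul, hMatrix_mul]
  congr 1 <;> ring

end Heisenberg

/-- The non-commuting pairs of elements of a group `G`. -/
def NCPair (G : Type u) [groupLang.Structure G] : Type u :=
  {w : G × G // ¬ ∃ z, IsMul w.1 w.2 z ∧ IsMul w.2 w.1 z}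

/-- The image of a non-commuting pair under an isomorphism. -/
def NCPair.map {G : Type u} {G' : Type v} [groupLang.Structure G] [groupLang.Structure G']
    (θ : G ≃[groupLang] G') (w : NCPair G) : NCPair G' :=
  ⟨(θ w.1.1, θ w.1.2), by
    rintro ⟨z, hz⟩
    refine w.2 ⟨θ.symm z, ?_⟩
    have key : ∀ x y : G, IsMul (θ x) (θ y) z → IsMul x y (θ.symm z) := by
      intro x y hxy
      unfold IsMul at hxy ⊢
      rw [← θ.map_rel]
      convert hxy using 1
      funext i
      fin_cases i <;> simp
    exact ⟨key _ _ hz.1, key _ _ hz.2⟩⟩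

/-! ### The fields defined in the Heisenberg group -/

section Maltsev

variable {F : Type u} [Field F]

/-- The underlying set of the field `F_(u,v)` defined in `H(F)`: the center of `H(F)`. -/
def MaltsevField (_w : NCPair (Heisenberg F)) : Type u := Subgroup.center (Heisenberg F)

/-- An element of `F_(u,v)` as an element of `H(F)`. -/
def MaltsevField.toH {w : NCPair (Heisenberg F)} (x : MaltsevField w) : Heisenberg F := x.1

/-- The operations of `F_(u,v)`: the sum is the product in `H(F)`, and the product of `x` and `y`
is `z` if there are `x', y'` with `[x',u] = [y',v] = 1`, `[x',v] = x`, `[u,y'] = y` and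
`[x',y'] = z`. -/
instance maltsevStructure (w : NCPair (Heisenberg F)) : fieldLang.Structure (MaltsevField w) where
  funMap := fun f => nomatch f
  RelMap := fun R => match R with
    | FieldRel.add => fun a => (a 0).toH * (a 1).toH = (a 2).toH
    | FieldRel.mul => fun a => ∃ x' y' : Heisenberg F,
        comm x' w.1.1 = 1 ∧ comm y' w.1.2 = 1 ∧
        comm x' w.1.2 = (a 0).toH ∧ comm w.1.1 y' = (a 1).toH ∧ comm x' y' = (a 2).toH

/-- The function `g_(u,v)` from `F` to `F_(u,v)`, taking `α` to `h(0, 0, α Δ_(u,v))`. -/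
def gMap (w : NCPair (Heisenberg F)) (α : F) : MaltsevField w :=
  ⟨hElem 0 0 (α * Delta w.1.1 w.1.2), hElem_mem_center _⟩

/-- Let `θ` be an isomorphism from `G` onto `H(F)`, and let `θ` take the non-commuting pair
`(u,v)` of `G` to `w`. Then `κ` shows that the structure `K` is the field `F_(u,v)` as it is
defined in `G`: `K` consists of elements of `G`, and `θ` restricts to an isomorphism `κ` from `K`
onto `F_w`. -/
def IsRestriction {G : OmegaStructure groupLang} {K : OmegaStructure fieldLang}
    (θ : G.univ ≃[groupLang] Heisenberg F) {w : NCPair (Heisenberg F)}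
    (κ : K.univ ≃[fieldLang] MaltsevField w) : Prop :=
  ∀ x : K.univ, ∃ hx : (x : ℕ) ∈ G.univ, θ ⟨x, hx⟩ = (κ x).toH

end Maltsev

end HeisenbergFunctor

open HeisenbergFunctor
open scoped FirstOrder

/-!
The centralizers of `u` and of `v` in `H(F)` project onto two transversal lines of `F²`, so the
commutators with `v` and with `u` parametrize them modulo the center by the center. This makes
Maltsev's multiplication a function on the center, and `g_(u,v)` an isomorphism from `F` onto
`F_(u,v)`. With `u' = h(u'₁, u'₂, u'₃)` and `v'` likewise, `[u', v'] = h(0, 0, Δ_(u',v'))`, which is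
`g_(u,v)(Δ_(u',v') / Δ_(u,v))`. Hence `g_(u',v') ∘ g_(u,v)⁻¹` is the multiplication by `[u', v']` in
`F_(u,v)`. It is defined by an existential formula in the group, so isomorphisms of groups
preserve it.

For a copy `G`, the operator `Φ` searches for a non-commuting pair, the first one in an
enumeration of `G²`, and enumerates the operations defined from it. An operation on a set
decidable in `G` whose graph is enumerable in `G` is decidable in `G`, by Post's theorem, so `Φ`
produces the atomic diagram of a field. The same argument makes the graph of the isomorphism
`Ψ(G₁, p, G₂)` decidable in `(G₁, p, G₂)`.
-/

namespace HeisenbergFunctor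

open Encodable
open FirstOrder.Language (BoundedFormula Formula Term)
open FirstOrder.Language.Structure (RelMap)

/-! ### Relative computability, uniformly in the oracle -/

namespace TuringOperator

theorem exists_eval_eq_of_partrec {f : ℕ →. ℕ} (hf : Nat.Partrec f) :
    ∃ c : TuringOperator, ∀ A, c.eval A = f := by
  induction hf with
  | zero => exact ⟨zero, fun _ => rfl⟩
  | succ => exact ⟨succ, fun _ => rfl⟩
  | left => exact ⟨left, fun _ => rfl⟩
  | right => exact ⟨right, fun _ => rfl⟩
  | pair _ _ hf hg =>
    obtain ⟨c, hc⟩ := hf; obtain ⟨d, hd⟩ := hg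
    exact ⟨pair c d, fun A => by simp only [eval, hc, hd]; rfl⟩
  | comp _ _ hf hg =>
    obtain ⟨c, hc⟩ := hf; obtain ⟨d, hd⟩ := hg
    exact ⟨comp c d, fun A => by simp only [eval, hc, hd]; rfl⟩
  | prec _ _ hf hg =>
    obtain ⟨c, hc⟩ := hf; obtain ⟨d, hd⟩ := hg
    exact ⟨prec c d, fun A => by simp only [eval, hc, hd]; rfl⟩
  | rfind _ hf =>
    obtain ⟨c, hc⟩ := hf
    exact ⟨rfind c, fun A => by simp only [eval, hc]; rfl⟩

theorem eval_pair_eq_some {c d : TuringOperator} {A : ℕ → ℕ} {n a b : ℕ}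
    (hc : c.eval A n = Part.some a) (hd : d.eval A n = Part.some b) :
    (pair c d).eval A n = Part.some (Nat.pair a b) := by
  simp [eval, hc, hd, Seq.seq]

theorem eval_comp_of_eq_some {c d : TuringOperator} {A : ℕ → ℕ} {n a : ℕ}
    (hd : d.eval A n = Part.some a) : (comp c d).eval A n = c.eval A a := by
  simp only [eval, hd]
  exact Part.bind_some _ _

theorem Takes.unique {c : TuringOperator} {A B B' : ℕ → ℕ} (h : c.Takes A B)
    (h' : c.Takes A B') : B = B' :=
  funext fun n => Part.some_inj.1 ((h n).symm.trans (h' n))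

end TuringOperator

section Computability

open TuringOperator

variable {ι : Type*} {O : ι → ℕ → ℕ}
variable {α β γ : Type} [Primcodable α] [Primcodable β] [Primcodable γ]

/-- A family of total functions, each of which is computed from the oracle with the same index
by one and the same program. -/
def UniformlyComputable (O : ι → ℕ → ℕ) (f : ι → α → β) : Prop :=
  ∃ c : TuringOperator, ∀ i a, c.eval (O i) (encode a) = Part.some (encode (f i a))

/-- A family of predicates, each of which is decided from the oracle with the same index by one
and the same program. -/
def UniformlyDecidable (O : ι → ℕ → ℕ) (P : ι → α → Prop) : Prop :=
  ∃ b : ι → α → Bool, UniformlyComputable O b ∧ ∀ i a, b i a = true ↔ P i a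

/-- A family of predicates, each of which is enumerated from the oracle with the same index by
one and the same procedure: they are projections of a uniformly decidable family. -/
def UniformlyEnumerable (O : ι → ℕ → ℕ) (P : ι → α → Prop) : Prop :=
  ∃ R : ι → α × ℕ → Prop, UniformlyDecidable O R ∧ ∀ i a, P i a ↔ ∃ n, R i (a, n)

namespace UniformlyComputable

theorem of_computable {f : α → β} (hf : Computable f) : UniformlyComputable O fun _ => f := by
  obtain ⟨c, hc⟩ := exists_eval_eq_of_partrec hf
  exact ⟨c, fun i a => by simp [hc]⟩

theorem of_primrec {f : α → β} (hf : Primrec f) : UniformlyComputable O fun _ => f :=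
  of_computable hf.to_comp

theorem comp {f : ι → β → γ} {g : ι → α → β} (hf : UniformlyComputable O f)
    (hg : UniformlyComputable O g) : UniformlyComputable O fun i a => f i (g i a) := by
  obtain ⟨c, hc⟩ := hf
  obtain ⟨d, hd⟩ := hg
  exact ⟨c.comp d, fun i a => by rw [eval_comp_of_eq_some (hd i a), hc]⟩

theorem pair {f : ι → α → β} {g : ι → α → γ} (hf : UniformlyComputable O f)
    (hg : UniformlyComputable O g) : UniformlyComputable O fun i a => (f i a, g i a) := by
  obtain ⟨c, hc⟩ := hf
  obtain ⟨d, hd⟩ := hg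
  exact ⟨c.pair d, fun i a => by rw [eval_pair_eq_some (hc i a) (hd i a)]; rfl⟩

theorem vector {n : ℕ} {f : Fin n → ι → α → β} (hf : ∀ j, UniformlyComputable O (f j)) :
    UniformlyComputable O fun i a => List.Vector.ofFn fun j => f j i a := by
  induction n with
  | zero => exact of_computable (Computable.const _)
  | succ n ih => exact (of_primrec Primrec.vector_cons).comp ((hf 0).pair (ih fun j => hf j.succ))

theorem pi {n : ℕ} {f : Fin n → ι → α → β} (hf : ∀ j, UniformlyComputable O (f j)) :
    UniformlyComputable O fun i a j => f j i a := by
  convert (of_primrec Primrec.vector_get').comp (vector hf) using 4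
  exact (List.Vector.get_ofFn (fun j => f j _ _) _).symm

theorem vecCons {n : ℕ} {f : ι → α → β} {s : ι → α → Fin n → β} (hf : UniformlyComputable O f)
    (hs : ∀ j, UniformlyComputable O fun i a => s i a j) :
    ∀ j, UniformlyComputable O fun i a => Matrix.vecCons (f i a) (s i a) j :=
  Fin.cases hf hs

theorem oracle : UniformlyComputable O O :=
  ⟨.oracle, fun _ _ => rfl⟩

theorem sInf {P : ι → α × ℕ → Prop} (hP : UniformlyDecidable O P)
    (h : ∀ i a, ∃ n, P i (a, n)) : UniformlyComputable O fun i a => sInf {n | P i (a, n)} := by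
  obtain ⟨b, hb, hbP⟩ := hP
  obtain ⟨c, hc⟩ := (of_primrec (Primrec.encode.comp Primrec.not)).comp hb
  refine ⟨.rfind c, fun i a => ?_⟩
  have eval_eq : (TuringOperator.rfind c).eval (O i) (encode a) =
      Nat.rfind fun n => Part.some (b i (a, n)) := by
    change Nat.rfind _ = _
    congr 1
    funext n
    have := hc i (a, n)
    simp only [encode_prod_val, encode_nat] at this
    rw [this]
    cases b i (a, n) <;> simp
  rw [eval_eq, Part.eq_some_iff]
  refine Nat.mem_rfind.2 ⟨?_, fun {m} hm => ?_⟩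
  · exact Part.mem_some_iff.2 ((hbP i _).2 (Nat.sInf_mem (h i a))).symm
  · exact Part.mem_some_iff.2 (Bool.eq_false_iff.2 fun hb' =>
      Nat.notMem_of_lt_sInf hm ((hbP i _).1 hb')).symm

end UniformlyComputable

namespace UniformlyDecidable

variable {P Q : ι → α → Prop}

theorem of_iff (hP : UniformlyDecidable O P) (h : ∀ i a, Q i a ↔ P i a) :
    UniformlyDecidable O Q := by
  obtain ⟨b, hb, hbP⟩ := hP
  exact ⟨b, hb, fun i a => (hbP i a).trans (h i a).symm⟩

theorem of_primrecPred {P : α → Prop} (hP : PrimrecPred P) : UniformlyDecidable O fun _ => P := by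
  obtain ⟨_, h⟩ := hP
  exact ⟨_, .of_primrec h, fun _ _ => decide_eq_true_iff⟩

theorem comp {P : ι → β → Prop} {g : ι → α → β} (hP : UniformlyDecidable O P)
    (hg : UniformlyComputable O g) : UniformlyDecidable O fun i a => P i (g i a) := by
  obtain ⟨b, hb, hbP⟩ := hP
  exact ⟨_, hb.comp hg, fun i a => hbP i (g i a)⟩

theorem eq {f g : ι → α → β} (hf : UniformlyComputable O f) (hg : UniformlyComputable O g) :
    UniformlyDecidable O fun i a => f i a = g i a :=
  have := Classical.decEq β
  comp (P := fun _ p => p.1 = p.2) (of_primrecPred Primrec.eq) (hf.pair hg)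

theorem not (hP : UniformlyDecidable O P) : UniformlyDecidable O fun i a => ¬P i a := by
  obtain ⟨b, hb, hbP⟩ := hP
  exact ⟨_, (UniformlyComputable.of_primrec Primrec.not).comp hb, fun i a => by simp [← hbP]⟩

theorem and (hP : UniformlyDecidable O P) (hQ : UniformlyDecidable O Q) :
    UniformlyDecidable O fun i a => P i a ∧ Q i a := by
  obtain ⟨b, hb, hbP⟩ := hP
  obtain ⟨b', hb', hbQ⟩ := hQ
  exact ⟨_, (UniformlyComputable.of_primrec Primrec.and).comp (hb.pair hb'),
    fun i a => by simp [← hbP, ← hbQ]⟩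

theorem or (hP : UniformlyDecidable O P) (hQ : UniformlyDecidable O Q) :
    UniformlyDecidable O fun i a => P i a ∨ Q i a :=
  (hP.not.and hQ.not).not.of_iff fun _ _ => or_iff_not_and_not

theorem imp (hP : UniformlyDecidable O P) (hQ : UniformlyDecidable O Q) :
    UniformlyDecidable O fun i a => P i a → Q i a :=
  (hP.not.or hQ).of_iff fun _ _ => imp_iff_not_or

protected theorem const (p : Prop) : UniformlyDecidable O fun _ (_ : α) => p := by
  have := Classical.dec p
  exact of_primrecPred (PrimrecPred.of_eq (Primrec.eq.comp (Primrec.const (decide p))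
    (Primrec.const true)) fun _ => decide_eq_true_iff)

theorem exists_of_finite {κ : Type*} [Finite κ] {P : κ → ι → α → Prop}
    (hP : ∀ k, UniformlyDecidable O (P k)) : UniformlyDecidable O fun i a => ∃ k, P k i a := by
  induction κ using Finite.induction_empty_option with
  | of_equiv e ih => exact (ih fun k => hP (e k)).of_iff fun i a => e.surjective.exists
  | h_empty => exact (UniformlyDecidable.const False).of_iff fun i a => by simp
  | h_option ih => exact ((hP none).or (ih fun k => hP (some k))).of_iff fun i a => Option.exists

theorem forall_of_finite {κ : Type*} [Finite κ] {P : κ → ι → α → Prop}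
    (hP : ∀ k, UniformlyDecidable O (P k)) : UniformlyDecidable O fun i a => ∀ k, P k i a :=
  (exists_of_finite fun k => (hP k).not).not.of_iff fun _ _ => not_exists_not.symm

theorem image {e : α → β} {d : β → α} (he : Computable e) (hd : Computable d)
    (hde : Function.LeftInverse d e) (hP : UniformlyDecidable O P) :
    UniformlyDecidable O fun i b => ∃ a, e a = b ∧ P i a := by
  have hd : UniformlyComputable O fun _ => d := .of_computable hd
  have he : UniformlyComputable O fun _ => e := .of_computable he
  refine ((eq (he.comp hd) (.of_computable .id)).and (hP.comp hd)).of_iff fun i b => ?_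
  constructor
  · rintro ⟨a, rfl, ha⟩
    rw [hde a]
    exact ⟨rfl, ha⟩
  · exact fun h => ⟨d b, h⟩

theorem of_charFun {S : ι → Set ℕ} (hS : UniformlyComputable O fun i => charFun (S i)) :
    UniformlyDecidable O fun i n => n ∈ S i :=
  (eq hS (.of_computable (Computable.const 1))).of_iff fun i n => by
    simp [HeisenbergFunctor.charFun]

theorem charFun {S : ι → Set ℕ} (hS : UniformlyDecidable O fun i n => n ∈ S i) :
    UniformlyComputable O fun i => charFun (S i) := by
  obtain ⟨b, hb, hbS⟩ := hS
  obtain ⟨c, hc⟩ := (UniformlyComputable.of_primrec Primrec.encode).comp hb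
  refine ⟨c, fun i n => (hc i n).trans ?_⟩
  by_cases h : n ∈ S i
  · simp [HeisenbergFunctor.charFun, h, (hbS i n).2 h]
  · simp [HeisenbergFunctor.charFun, h, Bool.eq_false_iff.2 fun hb' => h ((hbS i n).1 hb')]

end UniformlyDecidable

namespace UniformlyEnumerable

variable {P Q : ι → α → Prop}

theorem of_iff (hP : UniformlyEnumerable O P) (h : ∀ i a, Q i a ↔ P i a) :
    UniformlyEnumerable O Q := by
  obtain ⟨R, hR, hRP⟩ := hP
  exact ⟨R, hR, fun i a => (h i a).trans (hRP i a)⟩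

theorem of_uniformlyDecidable (hP : UniformlyDecidable O P) : UniformlyEnumerable O P :=
  ⟨fun i p => P i p.1, hP.comp (.of_computable .fst), fun _ _ => exists_const _ |>.symm⟩

theorem comp {P : ι → β → Prop} {g : ι → α → β} (hP : UniformlyEnumerable O P)
    (hg : UniformlyComputable O g) : UniformlyEnumerable O fun i a => P i (g i a) := by
  obtain ⟨R, hR, hRP⟩ := hP
  exact ⟨fun i p => R i (g i p.1, p.2),
    hR.comp ((hg.comp (.of_computable .fst)).pair (.of_computable .snd)), fun i a => hRP i (g i a)⟩

theorem exists_nat {P : ι → α × ℕ → Prop} (hP : UniformlyEnumerable O P) :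
    UniformlyEnumerable O fun i a => ∃ n, P i (a, n) := by
  obtain ⟨R, hR, hRP⟩ := hP
  have regroup : Computable fun p : α × ℕ => ((p.1, p.2.unpair.1), p.2.unpair.2) := by
    have hu := Primrec.unpair.comp (Primrec.snd (α := α) (β := ℕ))
    exact ((Primrec.fst.pair (Primrec.fst.comp hu)).pair (Primrec.snd.comp hu)).to_comp
  refine ⟨_, hR.comp (.of_computable regroup), fun i a => ?_⟩
  simp only [hRP]
  exact ⟨fun ⟨n, m, h⟩ => ⟨Nat.pair n m, by simpa using h⟩, fun ⟨k, h⟩ => ⟨_, _, h⟩⟩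

theorem exists_of_nonempty [Nonempty β] {P : ι → α × β → Prop} (hP : UniformlyEnumerable O P) :
    UniformlyEnumerable O fun i a => ∃ b, P i (a, b) := by
  obtain ⟨b₀⟩ := ‹Nonempty β›
  have hdecode : Computable fun n => (decode (α := β) n).getD b₀ :=
    Computable.option_getD .decode (.const b₀)
  have hsurj : Function.Surjective fun n => (decode (α := β) n).getD b₀ := fun b =>
    ⟨encode b, by simp⟩
  refine (hP.comp (g := fun _ (p : α × ℕ) => (p.1, (decode (α := β) p.2).getD b₀))
    (.pair (.of_computable .fst) (.of_computable (hdecode.comp .snd)))).exists_nat.of_iff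
    fun i a => hsurj.exists

theorem and (hP : UniformlyEnumerable O P) (hQ : UniformlyEnumerable O Q) :
    UniformlyEnumerable O fun i a => P i a ∧ Q i a := by
  obtain ⟨R, hR, hRP⟩ := hP
  obtain ⟨S, hS, hSQ⟩ := hQ
  have hRS : UniformlyEnumerable O
      fun i (p : (α × ℕ) × ℕ) => R i (p.1.1, p.1.2) ∧ S i (p.1.1, p.2) :=
    of_uniformlyDecidable <| (hR.comp (.of_computable .fst)).and
      (hS.comp (.pair (.of_computable (Computable.fst.comp .fst)) (.of_computable .snd)))
  exact hRS.exists_nat.exists_nat.of_iff fun i a => by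
    simp only [hRP, hSQ, exists_and_left, exists_and_right]

theorem or (hP : UniformlyEnumerable O P) (hQ : UniformlyEnumerable O Q) :
    UniformlyEnumerable O fun i a => P i a ∨ Q i a := by
  obtain ⟨R, hR, hRP⟩ := hP
  obtain ⟨S, hS, hSQ⟩ := hQ
  exact ⟨_, hR.or hS, fun i a => by simp only [hRP, hSQ, exists_or]⟩

end UniformlyEnumerable

/-- Post's theorem: search for a witness of membership or of non-membership. -/
theorem UniformlyDecidable.of_uniformlyEnumerable {P : ι → α → Prop}
    (hP : UniformlyEnumerable O P) (hP' : UniformlyEnumerable O fun i a => ¬P i a) :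
    UniformlyDecidable O P := by
  obtain ⟨R, hR, hRP⟩ := hP
  obtain ⟨S, hS, hSP⟩ := hP'
  have halts : ∀ i a, ∃ n, R i (a, n) ∨ S i (a, n) := fun i a => by
    rw [exists_or, ← hRP, ← hSP]
    exact em _
  refine (hR.comp (.pair (.of_computable .id) (.sInf (hR.or hS) halts))).of_iff fun i a => ?_
  refine ⟨fun hPa => ?_, fun h => (hRP i a).2 ⟨_, h⟩⟩
  exact (Nat.sInf_mem (halts i a)).resolve_right fun h => (hSP i a).2 ⟨_, h⟩ hPa

/-- The value of a function at `a` is not `y` exactly if it is some `y' ≠ y`. -/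
theorem UniformlyDecidable.of_functional {P : ι → α × ℕ → Prop} {D : ι → α → Prop}
    (hP : UniformlyEnumerable O P) (hD : UniformlyDecidable O D)
    (hPD : ∀ i a y, P i (a, y) → D i a) (total : ∀ i a, D i a → ∃ y, P i (a, y))
    (functional : ∀ i a y y', P i (a, y) → P i (a, y') → y = y') : UniformlyDecidable O P := by
  refine .of_uniformlyEnumerable hP ?_
  have other_value : UniformlyEnumerable O fun i (p : α × ℕ) => ∃ y', P i (p.1, y') ∧ p.2 ≠ y' :=
    .exists_nat (P := fun i (q : (α × ℕ) × ℕ) => P i (q.1.1, q.2) ∧ q.1.2 ≠ q.2) <|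
      (hP.comp (.pair (.of_computable (Computable.fst.comp .fst)) (.of_computable .snd))).and
        (.of_uniformlyDecidable (UniformlyDecidable.eq
          (.of_computable (Computable.snd.comp .fst)) (.of_computable .snd)).not)
  refine ((UniformlyEnumerable.of_uniformlyDecidable
    (hD.not.comp (.of_computable .fst))).or other_value).of_iff fun i ⟨a, y⟩ => ?_
  refine ⟨fun hPy => or_iff_not_imp_left.2 fun hDa => ?_, ?_⟩
  · obtain ⟨y', hy'⟩ := total i a (not_not.1 hDa)
    exact ⟨y', hy', fun h : y = y' => hPy (h ▸ hy')⟩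
  · rintro (hDa | ⟨y', hy', hne⟩) hPy
    · exact hDa (hPD i a y hPy)
    · exact hne (functional i a y y' hPy hy')

end Computability

/-! ### Atomic diagrams -/

theorem charFun_injective : Function.Injective charFun := fun _ _ h =>
  Set.indicator_one_inj ℕ h

theorem graphCode_injective {X Y : Set ℕ} : Function.Injective (graphCode (X := X) (Y := Y)) := by
  intro p q h
  funext x
  obtain ⟨y, hy⟩ : Nat.pair x (p x) ∈ graphCode q := h ▸ ⟨x, rfl⟩
  obtain ⟨hx, hpq⟩ := Nat.pair_eq_pair.1 hy
  rw [Subtype.ext hpq, Subtype.ext hx]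

theorem mapCode_injective {L : FirstOrder.Language.{0, 0}} {M N : OmegaStructure L} :
    Function.Injective (mapCode (M := M) (N := N)) := fun _ _ h =>
  DFunLike.coe_injective (graphCode_injective (charFun_injective h))

section Diagram

variable {L : FirstOrder.Language.{0, 0}} [∀ n, Encodable (L.Relations n)]

theorem AtomicSentence.godel_injective :
    Function.Injective (AtomicSentence.godel (L := L)) := by
  rintro (⟨a, b⟩ | @⟨n, R, a⟩) (⟨a', b'⟩ | @⟨n', R', a'⟩) h
  · simp only [godel, Nat.pair_eq_pair] at h
    rw [h.2.1, h.2.2]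
  · simp [godel, Nat.pair_eq_pair] at h
  · simp [godel, Nat.pair_eq_pair] at h
  · simp only [godel, Nat.pair_eq_pair] at h
    obtain ⟨-, rfl, hR, ha⟩ := h
    rw [encode_injective hR, List.ofFn_injective (encode_injective ha)]

section Mem

variable [L.IsRelational] {M : OmegaStructure L} {φ : AtomicSentence L} {k : ℕ}

theorem mem_atomicDiagram_iff : k ∈ atomicDiagram M ↔
    (k.unpair.1 = 0 ∧ ∃ φ : AtomicSentence L, φ.godel = k.unpair.2 ∧ φ.TrueIn M) ∨
    (k.unpair.1 = 1 ∧ ∃ φ : AtomicSentence L, φ.godel = k.unpair.2 ∧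
      φ.NamesIn M ∧ ¬φ.TrueIn M) := by
  constructor
  · rintro ⟨φ, ⟨hφ, rfl⟩ | ⟨hφ, hφ', rfl⟩⟩
    · exact .inl (by simpa using ⟨φ, rfl, hφ⟩)
    · exact .inr (by simpa using ⟨φ, rfl, hφ, hφ'⟩)
  · rintro (⟨h, φ, hφk, hφ⟩ | ⟨h, φ, hφk, hφ⟩)
    · exact ⟨φ, .inl ⟨hφ, by rw [hφk, ← h, Nat.pair_unpair]⟩⟩
    · exact ⟨φ, .inr ⟨hφ.1, hφ.2, by rw [hφk, ← h, Nat.pair_unpair]⟩⟩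

theorem pair_zero_godel_mem_atomicDiagram :
    Nat.pair 0 φ.godel ∈ atomicDiagram M ↔ φ.TrueIn M := by
  simp [mem_atomicDiagram_iff, AtomicSentence.godel_injective.eq_iff]

end Mem

theorem structureCode_injective [L.IsRelational] : Function.Injective (structureCode (L := L)) := by
  intro M N h
  have trueIn_iff : ∀ φ : AtomicSentence L, φ.TrueIn M ↔ φ.TrueIn N := fun φ => by
    rw [← pair_zero_godel_mem_atomicDiagram, charFun_injective h, pair_zero_godel_mem_atomicDiagram]
  obtain ⟨X, S⟩ := M
  obtain ⟨Y, T⟩ := N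
  obtain rfl : X = Y := by
    ext a
    simpa [AtomicSentence.TrueIn] using trueIn_iff (.eq a a)
  congr 1
  refine FirstOrder.Language.Structure.ext ?_ ?_
  · funext n f
    exact isEmptyElim f
  · funext n R x
    have := trueIn_iff (.rel R fun i => x i)
    simp only [AtomicSentence.TrueIn, Subtype.coe_prop, implies_true, Subtype.coe_eta,
      exists_true_left] at this
    exact propext this

section Effective

variable {ι : Type*} {O : ι → ℕ → ℕ} {M : ι → OmegaStructure L}

theorem primrec_godel_eq :
    Primrec fun p : ℕ × ℕ => (AtomicSentence.eq (L := L) p.1 p.2).godel :=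
  Primrec₂.natPair.comp (.const 0) (Primrec₂.natPair.comp .fst .snd)

theorem primrec_godel_rel {n : ℕ} (R : L.Relations n) :
    Primrec fun a => (AtomicSentence.rel R a).godel :=
  Primrec₂.natPair.comp (.const 1) <| Primrec₂.natPair.comp (.const n) <|
    Primrec₂.natPair.comp (.const _) <|
      Primrec.encode.comp <| Primrec.list_ofFn fun j => Primrec.fin_app.comp .id (.const j)

theorem exists_computable_leftInverse_godel_eq : ∃ d : ℕ → ℕ × ℕ, Computable d ∧
    Function.LeftInverse d fun p => (AtomicSentence.eq (L := L) p.1 p.2).godel :=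
  ⟨fun k => k.unpair.2.unpair, (Primrec.unpair.comp (Primrec.snd.comp .unpair)).to_comp,
    fun p => by simp [AtomicSentence.godel]⟩

theorem exists_computable_leftInverse_godel_rel {n : ℕ} (R : L.Relations n) :
    ∃ d : ℕ → Fin n → ℕ, Computable d ∧
      Function.LeftInverse d fun a => (AtomicSentence.rel R a).godel := by
  have hsnd : Primrec fun k : ℕ => k.unpair.2 := Primrec.snd.comp .unpair
  refine ⟨fun k j => (Denumerable.ofNat (List ℕ) k.unpair.2.unpair.2.unpair.2).getD j 0,
    Primrec.to_comp (Primrec.fin_curry.2 ?_), fun a => ?_⟩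
  · exact (Primrec.list_getD 0).comp
      ((Primrec.ofNat (List ℕ)).comp (hsnd.comp (hsnd.comp (hsnd.comp .fst))))
      (Primrec.fin_val.comp .snd)
  · funext j
    simp [AtomicSentence.godel]

theorem uniformlyDecidable_exists_godel_eq [Finite (Σ n, L.Relations n)]
    {Q : ι → AtomicSentence L → Prop}
    (hEq : UniformlyDecidable O fun i (p : ℕ × ℕ) => Q i (.eq p.1 p.2))
    (hRel : ∀ {n} (R : L.Relations n), UniformlyDecidable O fun i a => Q i (.rel R a)) :
    UniformlyDecidable O fun i k => ∃ φ : AtomicSentence L, φ.godel = k ∧ Q i φ := by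
  obtain ⟨_, hd, hleft⟩ := exists_computable_leftInverse_godel_eq (L := L)
  have hEq' := hEq.image primrec_godel_eq.to_comp hd hleft
  have hRel' := UniformlyDecidable.exists_of_finite fun R : Σ n, L.Relations n => by
    obtain ⟨_, hd, hleft⟩ := exists_computable_leftInverse_godel_rel R.2
    exact (hRel R.2).image (primrec_godel_rel R.2).to_comp hd hleft
  refine (hEq'.or hRel').of_iff fun i k => ⟨?_, ?_⟩
  · rintro ⟨⟨a, b⟩ | @⟨n, R, a⟩, hk, h⟩
    · exact .inl ⟨(a, b), hk, h⟩
    · exact .inr ⟨⟨n, R⟩, a, hk, h⟩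
  · rintro (⟨p, h⟩ | ⟨R, a, h⟩)
    exacts [⟨_, h⟩, ⟨_, h⟩]

variable [L.IsRelational]

theorem uniformlyDecidable_trueIn_eq
    (hO : UniformlyComputable O fun i => structureCode (M i)) :
    UniformlyDecidable O fun i (p : ℕ × ℕ) => (AtomicSentence.eq p.1 p.2).TrueIn (M i) :=
  ((UniformlyDecidable.of_charFun hO).comp (.of_primrec <|
    Primrec₂.natPair.comp (.const 0) primrec_godel_eq)).of_iff fun _ _ =>
      pair_zero_godel_mem_atomicDiagram.symm

theorem uniformlyDecidable_trueIn_rel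
    (hO : UniformlyComputable O fun i => structureCode (M i)) {n : ℕ} (R : L.Relations n) :
    UniformlyDecidable O fun i a => (AtomicSentence.rel R a).TrueIn (M i) :=
  ((UniformlyDecidable.of_charFun hO).comp (.of_primrec <|
    Primrec₂.natPair.comp (.const 0) (primrec_godel_rel R))).of_iff fun _ _ =>
      pair_zero_godel_mem_atomicDiagram.symm

theorem uniformlyDecidable_mem_univ
    (hO : UniformlyComputable O fun i => structureCode (M i)) :
    UniformlyDecidable O fun i n => n ∈ (M i).univ :=
  ((uniformlyDecidable_trueIn_eq hO).comp (.of_primrec (Primrec.id.pair .id))).of_iff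
    fun _ _ => by simp [AtomicSentence.TrueIn]

theorem uniformlyComputable_structureCode [Finite (Σ n, L.Relations n)]
    (hUniv : UniformlyDecidable O fun i n => n ∈ (M i).univ)
    (hRel : ∀ {n} (R : L.Relations n),
      UniformlyDecidable O fun i a => (AtomicSentence.rel R a).TrueIn (M i)) :
    UniformlyComputable O fun i => structureCode (M i) := by
  have hFst : UniformlyDecidable O fun i (p : ℕ × ℕ) => p.1 ∈ (M i).univ :=
    hUniv.comp (.of_computable .fst)
  have hSnd : UniformlyDecidable O fun i (p : ℕ × ℕ) => p.2 ∈ (M i).univ :=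
    hUniv.comp (.of_computable .snd)
  have hTrueEq : UniformlyDecidable O fun i (p : ℕ × ℕ) =>
      (AtomicSentence.eq p.1 p.2).TrueIn (M i) :=
    hFst.and (hSnd.and (.eq (.of_computable .fst) (.of_computable .snd)))
  have hNamesRel : ∀ {n} (R : L.Relations n),
      UniformlyDecidable O fun i a => (AtomicSentence.rel R a).NamesIn (M i) := fun _ =>
    .forall_of_finite fun j =>
      hUniv.comp (.of_primrec (Primrec.fin_app.comp .id (.const j)))
  have hTrue := uniformlyDecidable_exists_godel_eq (Q := fun i φ => φ.TrueIn (M i)) hTrueEq hRel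
  have hFalse := uniformlyDecidable_exists_godel_eq
    (Q := fun i φ => φ.NamesIn (M i) ∧ ¬φ.TrueIn (M i))
    ((hFst.and hSnd).and hTrueEq.not) fun R => (hNamesRel R).and (hRel R).not
  have hTag : ∀ t, UniformlyDecidable O fun _ (k : ℕ) => k.unpair.1 = t := fun t =>
    .eq (.of_primrec (Primrec.fst.comp .unpair)) (.of_primrec (.const t))
  have hSentence : UniformlyComputable O fun _ (k : ℕ) => k.unpair.2 :=
    .of_primrec (Primrec.snd.comp .unpair)
  exact UniformlyDecidable.charFun <|
    (((hTag 0).and (hTrue.comp hSentence)).or ((hTag 1).and (hFalse.comp hSentence))).of_iff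
      fun _ _ => mem_atomicDiagram_iff

end Effective

end Diagram

section MapCode

variable {ι : Type*} {O : ι → ℕ → ℕ}

theorem pair_mem_graphCode {X Y : Set ℕ} {p : X → Y} {a b : ℕ} :
    Nat.pair a b ∈ graphCode p ↔ ∃ h : a ∈ X, (p ⟨a, h⟩ : ℕ) = b := by
  simp [graphCode, Nat.pair_eq_pair, Subtype.exists, eq_comm]

theorem uniformlyComputable_charFun_graphCode {X Y : ι → Set ℕ} {p : ∀ i, X i → Y i}
    (hX : UniformlyDecidable O fun i n => n ∈ X i)
    (hp : UniformlyEnumerable O fun i (k : ℕ × ℕ) => Nat.pair k.1 k.2 ∈ graphCode (p i)) :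
    UniformlyComputable O fun i => charFun (graphCode (p i)) := by
  have hgraph : UniformlyDecidable O fun i (k : ℕ × ℕ) => Nat.pair k.1 k.2 ∈ graphCode (p i) := by
    refine .of_functional hp hX ?_ ?_ ?_ <;> simp only [pair_mem_graphCode]
    · exact fun i a y ⟨ha, _⟩ => ha
    · exact fun i a ha => ⟨_, ha, rfl⟩
    · rintro i a y y' ⟨ha, rfl⟩ ⟨_, rfl⟩
      rfl
  exact ((hgraph.comp (.of_computable .unpair)).of_iff fun i k => by
    rw [Nat.pair_unpair]).charFun

end MapCode

/-! ### Existential definability -/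

section ExistentialFormulas

variable {L : FirstOrder.Language.{0, 0}} {α β : Type}

theorem isExistential_exs {n : ℕ} {φ : L.BoundedFormula α n} (hφ : φ.IsExistential) :
    φ.exs.IsExistential := by
  induction n with
  | zero => exact hφ
  | succ n ih => exact ih hφ.ex

theorem isExistential_iExs [Finite β] {φ : L.Formula (α ⊕ β)} (hφ : φ.IsQF) :
    (φ.iExs β).IsExistential :=
  isExistential_exs (.of_isQF (hφ.relabel _))

end ExistentialFormulas

section Existential

universe w

variable {L : FirstOrder.Language.{0, 0}} {ι : Type*} {M : ι → Type w} [∀ i, L.Structure (M i)]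
variable {α : Type}

/-- A family of relations on structures that is defined in all of them by one and the same
existential formula, whose quantified variables are indexed by a finite type `β`. -/
def UniformlyExistential (L : FirstOrder.Language.{0, 0}) {ι : Type*} {M : ι → Type w}
    [∀ i, L.Structure (M i)] {α : Type} (P : ∀ i, (α → M i) → Prop) : Prop :=
  ∃ (β : Type) (_ : Finite β) (φ : L.Formula (α ⊕ β)), φ.IsQF ∧
    ∀ i v, P i v ↔ ∃ y : β → M i, φ.Realize (Sum.elim v y)

namespace UniformlyExistential

theorem of_isQF {φ : L.Formula α} (hφ : φ.IsQF) :
    UniformlyExistential L fun i (v : α → M i) => φ.Realize v := by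
  refine ⟨Empty, inferInstance, Formula.relabel Sum.inl φ, hφ.relabel _,
    fun i v => ?_⟩
  simp

theorem rel {n : ℕ} (R : L.Relations n) (s : Fin n → α) :
    UniformlyExistential L fun i (v : α → M i) => RelMap R fun j => v (s j) := by
  convert of_isQF (M := M) (φ := R.formula fun j => Term.var (s j)) (.of_isAtomic (.rel _ _))
    using 3
  simp [Formula.realize_rel]

theorem not_rel {n : ℕ} (R : L.Relations n) (s : Fin n → α) :
    UniformlyExistential L fun i (v : α → M i) => ¬RelMap R fun j => v (s j) := by
  convert of_isQF (M := M) (φ := ∼(R.formula fun j => Term.var (s j)))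
    (BoundedFormula.IsQF.of_isAtomic (.rel _ _)).not using 3
  simp [Formula.realize_not, Formula.realize_rel]

theorem and {P Q : ∀ i, (α → M i) → Prop} (hP : UniformlyExistential L P)
    (hQ : UniformlyExistential L Q) : UniformlyExistential L fun i v => P i v ∧ Q i v := by
  obtain ⟨β, _, φ, hφ, hφP⟩ := hP
  obtain ⟨γ, _, χ, hχ, hχQ⟩ := hQ
  let φ' : L.Formula (α ⊕ β ⊕ γ) := φ.relabel (Sum.map id Sum.inl)
  let χ' : L.Formula (α ⊕ β ⊕ γ) := χ.relabel (Sum.map id Sum.inr)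
  refine ⟨β ⊕ γ, inferInstance, φ' ⊓ χ', (hφ.relabel _).inf (hχ.relabel _), fun i v => ?_⟩
  simp only [φ', χ', hφP, hχQ, Formula.realize_inf,
    Formula.realize_relabel, Sum.elim_comp_map, Function.comp_id]
  constructor
  · rintro ⟨⟨y, hy⟩, z, hz⟩
    exact ⟨Sum.elim y z, by simpa using hy, by simpa using hz⟩
  · rintro ⟨y, hy, hz⟩
    exact ⟨⟨_, hy⟩, _, hz⟩

theorem ex {P : ∀ i, (Option α → M i) → Prop} (hP : UniformlyExistential L P) :
    UniformlyExistential L fun i v => ∃ x, P i fun o => o.elim x v := by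
  obtain ⟨β, _, φ, hφ, hφP⟩ := hP
  let shift : Option α ⊕ β → α ⊕ Option β :=
    Sum.elim (fun o => o.elim (.inr none) .inl) fun b => .inr (some b)
  have elim_shift : ∀ i (v : α → M i) (y : Option β → M i), Sum.elim v y ∘ shift =
      Sum.elim (fun o => o.elim (y none) v) fun b => y (some b) := fun i v y => by
    funext j
    rcases j with (_ | _) | _ <;> rfl
  refine ⟨Option β, inferInstance, φ.relabel shift, hφ.relabel _, fun i v => ?_⟩
  simp only [hφP, Formula.realize_relabel, elim_shift]
  exact ⟨fun ⟨x, y, h⟩ => ⟨fun o => o.elim x y, h⟩, fun ⟨y, h⟩ => ⟨_, _, h⟩⟩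

theorem exists_isExistential {P : ∀ i, (α → M i) → Prop} (hP : UniformlyExistential L P) :
    ∃ ψ : L.Formula α, ψ.IsExistential ∧ ∀ i v, ψ.Realize v ↔ P i v := by
  obtain ⟨β, _, φ, hφ, hφP⟩ := hP
  exact ⟨φ.iExs β, isExistential_iExs hφ, fun i v => by
    rw [Formula.realize_iExs, hφP]⟩

end UniformlyExistential

end Existential

section Holds

variable {L : FirstOrder.Language.{0, 0}} {α : Type}

/-- All the numbers `a j` belong to the universe of `M`, and they satisfy the relation `P`. -/
def OmegaStructure.Holds (M : OmegaStructure L) (P : (α → M.univ) → Prop) (a : α → ℕ) : Prop :=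
  ∃ h : ∀ j, a j ∈ M.univ, P fun j => ⟨a j, h j⟩

theorem OmegaStructure.holds_imp_iff {M : OmegaStructure L} {P Q : (α → M.univ) → Prop}
    {a : α → ℕ} : M.Holds (fun v => P v → Q v) a ↔
      (∀ j, a j ∈ M.univ) ∧ (M.Holds P a → M.Holds Q a) :=
  ⟨fun ⟨h, hPQ⟩ => ⟨h, fun ⟨_, hP⟩ => ⟨h, hPQ hP⟩⟩, fun ⟨h, hPQ⟩ => ⟨h, fun hP => (hPQ ⟨h, hP⟩).2⟩⟩

theorem OmegaStructure.holds_exists_iff {β : Type} {M : OmegaStructure L}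
    {P : (α ⊕ β → M.univ) → Prop} {a : α → ℕ} :
    M.Holds (fun v => ∃ y, P (Sum.elim v y)) a ↔ ∃ b : β → ℕ, M.Holds P (Sum.elim a b) := by
  constructor
  · rintro ⟨h, y, hP⟩
    refine ⟨fun j => y j, by rintro (j | j); exacts [h j, (y j).2], ?_⟩
    convert hP using 1
    ext (j | j) <;> rfl
  · rintro ⟨b, h, hP⟩
    refine ⟨fun j => h (.inl j), fun j => ⟨b j, h (.inr j)⟩, ?_⟩
    convert hP using 1
    ext (j | j) <;> rfl

variable [L.IsRelational]

theorem exists_eq_var_inl (t : L.Term (α ⊕ Fin 0)) : ∃ a, t = Term.var (.inl a) := by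
  rcases t with (a | k) | ⟨f, _⟩
  · exact ⟨a, rfl⟩
  · exact k.elim0
  · exact isEmptyElim f

variable [∀ n, Encodable (L.Relations n)] {ι : Type*} {O : ι → ℕ → ℕ}
variable {M : ι → OmegaStructure L} {γ : Type} [Primcodable γ] [Finite α] {s : ι → γ → α → ℕ}

theorem uniformlyDecidable_forall_mem_univ
    (hO : UniformlyComputable O fun i => structureCode (M i))
    (hs : ∀ j, UniformlyComputable O fun i c => s i c j) :
    UniformlyDecidable O fun i c => ∀ j, s i c j ∈ (M i).univ :=
  .forall_of_finite fun j => (uniformlyDecidable_mem_univ hO).comp (hs j)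

theorem uniformlyDecidable_holds_realize
    (hO : UniformlyComputable O fun i => structureCode (M i))
    (hs : ∀ j, UniformlyComputable O fun i c => s i c j) {φ : L.Formula α} (hφ : φ.IsQF) :
    UniformlyDecidable O fun i c => (M i).Holds (fun v => φ.Realize v) (s i c) := by
  have hdom := uniformlyDecidable_forall_mem_univ hO hs
  induction hφ with
  | falsum => exact (UniformlyDecidable.const False).of_iff fun i c => ⟨fun h => h.2, False.elim⟩
  | of_isAtomic h =>
    rcases h with ⟨t, t'⟩ | ⟨R, ts⟩
    · obtain ⟨a, rfl⟩ := exists_eq_var_inl t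
      obtain ⟨b, rfl⟩ := exists_eq_var_inl t'
      refine (hdom.and (.eq (hs a) (hs b))).of_iff fun i c => ?_
      simp [OmegaStructure.Holds, Formula.Realize]
    · choose a ha using fun j => exists_eq_var_inl (ts j)
      refine (hdom.and ((uniformlyDecidable_trueIn_rel hO R).comp
        (.pi fun j => hs (a j)))).of_iff fun i c => ?_
      simp only [OmegaStructure.Holds, Formula.Realize,
        BoundedFormula.realize_rel, ha, Term.realize_var, Sum.elim_inl, AtomicSentence.TrueIn]
      exact ⟨fun ⟨h, hR⟩ => ⟨h, fun j => h (a j), hR⟩, fun ⟨h, _, hR⟩ => ⟨h, hR⟩⟩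
  | imp _ _ ih₁ ih₂ =>
    exact (hdom.and (ih₁.imp ih₂)).of_iff fun i c => OmegaStructure.holds_imp_iff

variable {P : ∀ i, (α → (M i).univ) → Prop}

theorem UniformlyExistential.uniformlyEnumerable (hP : UniformlyExistential L P)
    (hO : UniformlyComputable O fun i => structureCode (M i))
    (hs : ∀ j, UniformlyComputable O fun i c => s i c j) :
    UniformlyEnumerable O fun i c => (M i).Holds (P i) (s i c) := by
  obtain ⟨β, _, φ, hφ, hφP⟩ := hP
  obtain ⟨k, ⟨e⟩⟩ := Finite.exists_equiv_fin β
  have hnames : ∀ j, UniformlyComputable O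
      fun i (p : γ × (Fin k → ℕ)) => Sum.elim (s i p.1) (p.2 ∘ e) j := by
    rintro (j | j)
    · exact (hs j).comp (.of_computable .fst)
    · exact .of_primrec (Primrec.fin_app.comp .snd (.const (e j)))
  refine (UniformlyEnumerable.of_uniformlyDecidable
    (uniformlyDecidable_holds_realize hO hnames hφ)).exists_of_nonempty.of_iff fun i c => ?_
  rw [show P i = fun v => ∃ y, φ.Realize (Sum.elim v y) from funext fun v => propext (hφP i v),
    OmegaStructure.holds_exists_iff (P := fun v => φ.Realize v)]
  exact (e.arrowCongr (.refl ℕ)).symm.surjective.exists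

theorem UniformlyExistential.uniformlyDecidable (hP : UniformlyExistential L P)
    (hP' : UniformlyExistential L fun i v => ¬P i v)
    (hO : UniformlyComputable O fun i => structureCode (M i))
    (hs : ∀ j, UniformlyComputable O fun i c => s i c j) :
    UniformlyDecidable O fun i c => (M i).Holds (P i) (s i c) := by
  refine .of_uniformlyEnumerable (hP.uniformlyEnumerable hO hs) ?_
  refine ((hP'.uniformlyEnumerable hO hs).or (.of_uniformlyDecidable
    (uniformlyDecidable_forall_mem_univ hO hs).not)).of_iff fun i c => ?_
  by_cases h : ∀ j, s i c j ∈ (M i).univ <;> simp [OmegaStructure.Holds, h]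

end Holds

/-! ### Relations defined from the multiplication -/

section GroupRelations

section Defs

variable {G : Type*} [groupLang.Structure G]

/-- `x y = y x`, in a structure for the language of groups. -/
def Commutes (x y : G) : Prop :=
  ∃ z, IsMul x y z ∧ IsMul y x z

/-- `[x, y] = z`, written as `x y = y x z` so that no inverses occur. -/
def IsCommutator (x y z : G) : Prop :=
  ∃ p q, IsMul x y p ∧ IsMul y x q ∧ IsMul q z p

/-- The graph `x ⊗_(u,v) y = z` of the multiplication of `F_(u,v)`. -/
def IsMaltsevMul (u v x y z : G) : Prop :=
  ∃ x' y', Commutes x' u ∧ Commutes y' v ∧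
    IsCommutator x' v x ∧ IsCommutator u y' y ∧ IsCommutator x' y' z

/-- The graph of the isomorphism from `F_(u,v)` onto `F_(u',v')`, which turns out to be the
multiplication in `F_(u,v)` by the element `[u', v']`. -/
def IsTransfer (u v u' v' x y : G) : Prop :=
  ∃ e, IsCommutator u' v' e ∧ IsMaltsevMul u v x e y

end Defs

section Transport

variable {G G' : Type*} [groupLang.Structure G] [groupLang.Structure G'] (θ : G ≃[groupLang] G')
variable {u v u' v' x y z : G}

theorem isMul_map_iff : IsMul (θ x) (θ y) (θ z) ↔ IsMul x y z := by
  rw [IsMul, IsMul, ← θ.map_rel]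
  congr! 1
  ext j
  fin_cases j <;> rfl

theorem commutes_map_iff : Commutes (θ x) (θ y) ↔ Commutes x y := by
  simp only [Commutes, θ.surjective.exists, isMul_map_iff]

theorem isCommutator_map_iff : IsCommutator (θ x) (θ y) (θ z) ↔ IsCommutator x y z := by
  simp only [IsCommutator, θ.surjective.exists, isMul_map_iff]

theorem isMaltsevMul_map_iff :
    IsMaltsevMul (θ u) (θ v) (θ x) (θ y) (θ z) ↔ IsMaltsevMul u v x y z := by
  simp only [IsMaltsevMul, θ.surjective.exists, commutes_map_iff, isCommutator_map_iff]

theorem isTransfer_map_iff :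
    IsTransfer (θ u) (θ v) (θ u') (θ v') (θ x) (θ y) ↔ IsTransfer u v u' v' x y := by
  simp only [IsTransfer, θ.surjective.exists, isCommutator_map_iff, isMaltsevMul_map_iff]

end Transport

section Definability

universe w

variable {ι : Type*} {M : ι → Type w} [∀ i, groupLang.Structure (M i)] {α : Type}

theorem uniformlyExistential_isMul (a b c : α) :
    UniformlyExistential groupLang fun i (v : α → M i) => IsMul (v a) (v b) (v c) := by
  convert UniformlyExistential.rel (M := M) mulSymbol ![a, b, c] using 3 with i v
  rw [IsMul]
  congr! 1
  ext j
  fin_cases j <;> rfl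

theorem uniformlyExistential_not_isMul (a b c : α) :
    UniformlyExistential groupLang fun i (v : α → M i) => ¬IsMul (v a) (v b) (v c) := by
  convert UniformlyExistential.not_rel (M := M) mulSymbol ![a, b, c] using 4 with i v
  rw [IsMul]
  congr! 1
  ext j
  fin_cases j <;> rfl

theorem uniformlyExistential_commutes (a b : α) :
    UniformlyExistential groupLang fun i (v : α → M i) => Commutes (v a) (v b) :=
  .ex ((uniformlyExistential_isMul (some a) (some b) none).and
    (uniformlyExistential_isMul (some b) (some a) none))

theorem not_commutes_iff {G : Type*} [groupLang.Structure G]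
    (hG : ∀ x y : G, ∃! z, IsMul x y z) {x y : G} :
    ¬Commutes x y ↔ ∃ z, IsMul x y z ∧ ¬IsMul y x z := by
  obtain ⟨z, hz, hz_unique⟩ := hG x y
  rw [Commutes, not_exists]
  refine ⟨fun h => ⟨z, hz, fun h' => h z ⟨hz, h'⟩⟩, ?_⟩
  rintro ⟨z', hz', hne⟩ z'' ⟨hz'', h⟩
  rw [hz_unique z' hz', ← hz_unique z'' hz''] at hne
  exact hne h

theorem uniformlyExistential_not_commutes (hM : ∀ i (x y : M i), ∃! z, IsMul x y z) (a b : α) :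
    UniformlyExistential groupLang fun i (v : α → M i) => ¬Commutes (v a) (v b) := by
  have h (i : ι) (v : α → M i) :
      ¬Commutes (v a) (v b) ↔ ∃ z, IsMul (v a) (v b) z ∧ ¬IsMul (v b) (v a) z :=
    not_commutes_iff (hM i)
  simp only [h]
  exact .ex ((uniformlyExistential_isMul (some a) (some b) none).and
    (uniformlyExistential_not_isMul (some b) (some a) none))

theorem uniformlyExistential_isCommutator (a b c : α) :
    UniformlyExistential groupLang fun i (v : α → M i) => IsCommutator (v a) (v b) (v c) :=
  .ex <| .ex <| (uniformlyExistential_isMul (some (some a)) (some (some b)) (some none)).and <|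
    (uniformlyExistential_isMul (some (some b)) (some (some a)) none).and <|
      uniformlyExistential_isMul none (some (some c)) (some none)

theorem uniformlyExistential_isMaltsevMul (u v a b c : α) : UniformlyExistential groupLang
    fun i (s : α → M i) => IsMaltsevMul (s u) (s v) (s a) (s b) (s c) :=
  .ex <| .ex <| (uniformlyExistential_commutes (some none) (some (some u))).and <|
    (uniformlyExistential_commutes none (some (some v))).and <|
    (uniformlyExistential_isCommutator (some none) (some (some v)) (some (some a))).and <|
    (uniformlyExistential_isCommutator (some (some u)) none (some (some b))).and <|
      uniformlyExistential_isCommutator (some none) none (some (some c))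

theorem uniformlyExistential_isTransfer (u v u' v' a b : α) : UniformlyExistential groupLang
    fun i (s : α → M i) => IsTransfer (s u) (s v) (s u') (s v') (s a) (s b) :=
  .ex <| (uniformlyExistential_isCommutator (some u') (some v') none).and <|
    uniformlyExistential_isMaltsevMul (some u) (some v) (some a) none (some b)

end Definability

end GroupRelations

/-! ### Maltsev's fields and the isomorphisms between them -/

section Algebra

variable {F : Type u} [Field F]

theorem exists_eq_hElem (x : Heisenberg F) : ∃ a b c, x = hElem a b c := by
  obtain ⟨_, a, b, c, rfl⟩ := x
  exact ⟨a, b, c, rfl⟩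

theorem hElem_mul (a b c a' b' c' : F) :
    hElem a b c * hElem a' b' c' = hElem (a + a') (b + b') (c + c' + a * b') :=
  Subtype.ext (hMatrix_mul a b c a' b' c')

theorem hElem_inj {a b c a' b' c' : F} :
    hElem a b c = hElem a' b' c' ↔ a = a' ∧ b = b' ∧ c = c' := by
  refine ⟨fun h => ?_, by rintro ⟨rfl, rfl, rfl⟩; rfl⟩
  have h' : ∀ i j, (hElem a b c).1.1 i j = (hElem a' b' c').1.1 i j := by simp [h]
  exact ⟨by simpa [hElem, hMatrix] using h' 0 1, by simpa [hElem, hMatrix] using h' 1 2,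
    by simpa [hElem, hMatrix] using h' 0 2⟩

theorem hElem_zero : hElem 0 0 0 = (1 : Heisenberg F) := by
  have h := hElem_mul (0 : F) 0 0 0 0 0
  simpa using h

theorem hElem_center_mul (c d : F) : hElem 0 0 c * hElem 0 0 d = hElem 0 0 (c + d) := by
  rw [hElem_mul, hElem_inj]
  simp

theorem Delta_hElem (a b c a' b' c' : F) :
    Delta (hElem a b c) (hElem a' b' c') = a * b' - a' * b := by
  simp [Delta, hElem, hMatrix]

section Commutators

variable {u v x y z : Heisenberg F}

theorem comm_eq_iff : comm x y = z ↔ x * y = y * x * z := by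
  unfold comm
  rw [← mul_right_inj (y * x)]
  group

theorem comm_eq_hElem (x y : Heisenberg F) : comm x y = hElem 0 0 (Delta x y) := by
  obtain ⟨a, b, c, rfl⟩ := exists_eq_hElem x
  obtain ⟨a', b', c', rfl⟩ := exists_eq_hElem y
  rw [comm_eq_iff, Delta_hElem]
  simp only [hElem_mul, hElem_inj]
  exact ⟨by ring, by ring, by ring⟩

theorem isMul_iff : IsMul x y z ↔ x * y = z :=
  Iff.rfl

theorem commutes_iff_comm_eq_one : Commutes x y ↔ comm x y = 1 := by
  rw [comm_eq_iff, mul_one]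
  exact ⟨fun ⟨_, h, h'⟩ => h.trans h'.symm, fun h => ⟨_, isMul_iff.2 rfl, isMul_iff.2 h.symm⟩⟩

theorem commutes_iff_Delta_eq_zero : Commutes x y ↔ Delta x y = 0 := by
  rw [commutes_iff_comm_eq_one, comm_eq_hElem, ← hElem_zero, hElem_inj]
  simp

theorem isCommutator_iff : IsCommutator x y z ↔ comm x y = z := by
  simp only [IsCommutator, isMul_iff, comm_eq_iff]
  exact ⟨by rintro ⟨_, _, rfl, rfl, h⟩; exact h.symm, fun h => ⟨_, _, rfl, rfl, h.symm⟩⟩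

theorem exists_eq_hElem_of_commutes (h : Delta u v ≠ 0) (hu : Commutes x u) (hv : Commutes x v) :
    ∃ α, x = hElem 0 0 (α * Delta u v) := by
  obtain ⟨a, b, c, rfl⟩ := exists_eq_hElem u
  obtain ⟨a', b', c', rfl⟩ := exists_eq_hElem v
  obtain ⟨p, q, r, rfl⟩ := exists_eq_hElem x
  rw [commutes_iff_Delta_eq_zero] at hu hv
  simp only [Delta_hElem] at *
  refine ⟨r / (a * b' - a' * b), hElem_inj.2 ⟨?_, ?_, ?_⟩⟩
  · apply mul_right_cancel₀ h; linear_combination a * hv - a' * hu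
  · apply mul_right_cancel₀ h; linear_combination b * hv - b' * hu
  · rw [div_mul_cancel₀ _ h]

theorem isMaltsevMul_iff_exists_comm : IsMaltsevMul u v x y z ↔ ∃ x' y' : Heisenberg F,
    comm x' u = 1 ∧ comm y' v = 1 ∧ comm x' v = x ∧ comm u y' = y ∧ comm x' y' = z := by
  simp only [IsMaltsevMul, commutes_iff_comm_eq_one, isCommutator_iff]

theorem isMaltsevMul_iff (h : Delta u v ≠ 0) : IsMaltsevMul u v x y z ↔
    ∃ α β, x = hElem 0 0 (α * Delta u v) ∧ y = hElem 0 0 (β * Delta u v) ∧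
      z = hElem 0 0 (α * β * Delta u v) := by
  simp only [isMaltsevMul_iff_exists_comm, comm_eq_hElem, ← hElem_zero, hElem_inj, true_and]
  obtain ⟨u₁, u₂, u₃, rfl⟩ := exists_eq_hElem u
  obtain ⟨v₁, v₂, v₃, rfl⟩ := exists_eq_hElem v
  constructor
  · rintro ⟨x', y', hx, hy, rfl, rfl, rfl⟩
    obtain ⟨x₁, x₂, x₃, rfl⟩ := exists_eq_hElem x'
    obtain ⟨y₁, y₂, y₃, rfl⟩ := exists_eq_hElem y'
    simp only [Delta_hElem] at *
    refine ⟨(x₁ * v₂ - v₁ * x₂) / (u₁ * v₂ - v₁ * u₂), (u₁ * y₂ - y₁ * u₂) / (u₁ * v₂ - v₁ * u₂),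
      ?_, ?_, ?_⟩
    · rw [div_mul_cancel₀ _ h]
    · rw [div_mul_cancel₀ _ h]
    · rw [hElem_inj]
      refine ⟨rfl, rfl, ?_⟩
      rw [mul_assoc, div_mul_cancel₀ _ h, div_mul_eq_mul_div, eq_div_iff h]
      linear_combination (y₁ * v₂ - v₁ * y₂) * hx
  · rintro ⟨α, β, rfl, rfl, rfl⟩
    refine ⟨hElem (α * u₁) (α * u₂) 0, hElem (β * v₁) (β * v₂) 0, ?_⟩
    simp only [Delta_hElem, hElem_inj, true_and]
    exact ⟨by ring, by ring, by ring, by ring, by ring⟩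

end Commutators

variable (w w' w'' : NCPair (Heisenberg F))

theorem NCPair.Delta_ne_zero : Delta w.1.1 w.1.2 ≠ 0 := fun h =>
  w.2 (commutes_iff_Delta_eq_zero.2 h)

theorem mem_center_iff_commutes {x : Heisenberg F} :
    x ∈ Subgroup.center (Heisenberg F) ↔ Commutes x w.1.1 ∧ Commutes x w.1.2 := by
  constructor
  · intro hx
    rw [Subgroup.mem_center_iff] at hx
    exact ⟨⟨_, isMul_iff.2 rfl, isMul_iff.2 (hx _)⟩, ⟨_, isMul_iff.2 rfl, isMul_iff.2 (hx _)⟩⟩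
  · rintro ⟨hu, hv⟩
    obtain ⟨α, rfl⟩ := exists_eq_hElem_of_commutes w.Delta_ne_zero hu hv
    exact hElem_mem_center _

theorem toH_injective {w : NCPair (Heisenberg F)} :
    Function.Injective (MaltsevField.toH (w := w)) :=
  Subtype.val_injective

theorem gMap_bijective : Function.Bijective (gMap w) := by
  have hΔ := w.Delta_ne_zero
  constructor
  · intro α β h
    exact mul_right_cancel₀ hΔ (hElem_inj.1 (congrArg MaltsevField.toH h)).2.2
  · intro x
    obtain ⟨hu, hv⟩ := (mem_center_iff_commutes w).1 x.2
    obtain ⟨α, hα⟩ := exists_eq_hElem_of_commutes hΔ hu hv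
    exact ⟨α, Subtype.ext hα.symm⟩

theorem toH_gMap (α : F) : (gMap w α).toH = hElem 0 0 (α * Delta w.1.1 w.1.2) :=
  rfl

theorem isMaltsevMul_gMap_iff {α β γ : F} :
    IsMaltsevMul w.1.1 w.1.2 (gMap w α).toH (gMap w β).toH (gMap w γ).toH ↔ α * β = γ := by
  have hΔ := w.Delta_ne_zero
  simp only [isMaltsevMul_iff hΔ, toH_gMap, hElem_inj, true_and]
  constructor
  · rintro ⟨α', β', hα, hβ, hγ⟩
    rw [mul_right_cancel₀ hΔ hα, mul_right_cancel₀ hΔ hβ, mul_right_cancel₀ hΔ hγ]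
  · rintro rfl
    exact ⟨α, β, rfl, rfl, rfl⟩

theorem relMap_mul_maltsevField_iff {a : Fin 3 → MaltsevField w} :
    RelMap (L := fieldLang) FieldRel.mul a ↔
      IsMaltsevMul w.1.1 w.1.2 (a 0).toH (a 1).toH (a 2).toH :=
  isMaltsevMul_iff_exists_comm.symm

/-- The function `g_(u,v)` as an isomorphism of fields. -/
noncomputable def gEquiv : F ≃[fieldLang] MaltsevField w where
  toEquiv := Equiv.ofBijective (gMap w) (gMap_bijective w)
  map_fun' := fun f => nomatch f
  map_rel' := by
    intro n R a
    cases R with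
    | add =>
      change hElem 0 0 _ * hElem 0 0 _ = hElem 0 0 _ ↔ a 0 + a 1 = a 2
      simp [hElem_center_mul, hElem_inj, ← add_mul, w.Delta_ne_zero]
    | mul => exact (relMap_mul_maltsevField_iff w).trans (isMaltsevMul_gMap_iff w)

theorem gEquiv_apply (α : F) : gEquiv w α = gMap w α :=
  rfl

/-- The isomorphism `f_(w,w')`. -/
noncomputable def fEquiv : MaltsevField w ≃[fieldLang] MaltsevField w' :=
  (gEquiv w').comp (gEquiv w).symm

theorem fEquiv_gMap (α : F) : fEquiv w w' (gMap w α) = gMap w' α := by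
  rw [← gEquiv_apply, ← gEquiv_apply]
  simp [fEquiv]

theorem fEquiv_self : fEquiv w w = FirstOrder.Language.Equiv.refl fieldLang (MaltsevField w) := by
  ext x
  obtain ⟨α, rfl⟩ := (gMap_bijective w).surjective x
  simp [fEquiv_gMap]

theorem fEquiv_comp : fEquiv w w'' = (fEquiv w' w'').comp (fEquiv w w') := by
  ext x
  obtain ⟨α, rfl⟩ := (gMap_bijective w).surjective x
  simp [fEquiv_gMap]

/-- Since `[u', v'] = g_w (Δ_w' / Δ_w)`, multiplying `g_w α` by it gives `h(0, 0, α Δ_w')`. -/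
theorem isTransfer_iff_exists_gMap {x y : Heisenberg F} :
    IsTransfer w.1.1 w.1.2 w'.1.1 w'.1.2 x y ↔
      ∃ α, (gMap w α).toH = x ∧ (gMap w' α).toH = y := by
  have hΔ := w.Delta_ne_zero
  simp only [IsTransfer, isCommutator_iff, exists_eq_left', isMaltsevMul_iff hΔ, comm_eq_hElem,
    toH_gMap, hElem_inj, true_and]
  constructor
  · rintro ⟨α, β, rfl, h, rfl⟩
    exact ⟨α, rfl, by rw [h, mul_assoc]⟩
  · rintro ⟨α, rfl, rfl⟩
    refine ⟨α, Delta w'.1.1 w'.1.2 / Delta w.1.1 w.1.2, rfl, (div_mul_cancel₀ _ hΔ).symm, ?_⟩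
    rw [mul_assoc, div_mul_cancel₀ _ hΔ]

theorem isTransfer_iff {x y : Heisenberg F} :
    IsTransfer w.1.1 w.1.2 w'.1.1 w'.1.2 x y ↔
      ∃ a : MaltsevField w, a.toH = x ∧ (fEquiv w w' a).toH = y := by
  simp only [isTransfer_iff_exists_gMap, (gMap_bijective w).surjective.exists, fEquiv_gMap]

end Algebra

/-! ### The fields defined in the copies of the Heisenberg group -/

section DefinedField

variable {G : OmegaStructure groupLang}

/-- The centralizer of `u` and `v`, for `w = (u, v)`. In a copy of a Heisenberg group it is the
center, but in contrast to centrality, membership is given by an existential formula. -/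
def NCPair.centralizer (w : NCPair G.univ) : Set ℕ :=
  {n | ∃ h : n ∈ G.univ, Commutes ⟨n, h⟩ w.1.1 ∧ Commutes ⟨n, h⟩ w.1.2}

/-- An element of the centralizer of `w` as an element of `G`. -/
def NCPair.incl {w : NCPair G.univ} (x : w.centralizer) : G.univ :=
  ⟨x, x.2.fst⟩

/-- The field `F_(u,v)` as it is defined in `G`, for `w = (u, v)`. -/
def definedField (G : OmegaStructure groupLang) (w : NCPair G.univ) : OmegaStructure fieldLang where
  univ := w.centralizer
  str :=
    { funMap := fun f => nomatch f
      RelMap := fun R => match R with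
        | FieldRel.add => fun a => IsMul (NCPair.incl (a 0)) (NCPair.incl (a 1)) (NCPair.incl (a 2))
        | FieldRel.mul => fun a =>
            IsMaltsevMul w.1.1 w.1.2 (NCPair.incl (a 0)) (NCPair.incl (a 1)) (NCPair.incl (a 2)) }

theorem NCPair.incl_injective {w : NCPair G.univ} : Function.Injective (incl (w := w)) :=
  fun _ _ h => Subtype.ext (congrArg Subtype.val h :)

variable {F : Type u} [Field F] (θ : G.univ ≃[groupLang] Heisenberg F) (w : NCPair G.univ)

theorem mem_center_map_iff_mem_centralizer (x : G.univ) :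
    θ x ∈ Subgroup.center (Heisenberg F) ↔ (x : ℕ) ∈ w.centralizer := by
  rw [mem_center_iff_commutes (w.map θ)]
  exact (and_congr (commutes_map_iff θ) (commutes_map_iff θ)).trans
    ⟨fun h => ⟨x.2, h⟩, fun ⟨_, h⟩ => h⟩

/-- The restriction of an isomorphism `θ` from `G` onto `H(F)` to the defined fields. -/
noncomputable def restrict : (definedField G w).univ ≃[fieldLang] MaltsevField (w.map θ) where
  toEquiv := Equiv.ofBijective
    (fun x => ⟨θ (NCPair.incl x), (mem_center_map_iff_mem_centralizer θ w _).2 x.2⟩)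
    ⟨fun _ _ h => NCPair.incl_injective (θ.injective (congrArg Subtype.val h)),
      fun ⟨y, hy⟩ => by
        obtain ⟨x, rfl⟩ := θ.surjective y
        exact ⟨⟨x, (mem_center_map_iff_mem_centralizer θ w x).1 hy⟩, rfl⟩⟩
  map_fun' := fun f => nomatch f
  map_rel' := by
    intro n R a
    cases R with
    | add => exact isMul_map_iff θ
    | mul => exact (relMap_mul_maltsevField_iff _).trans (isMaltsevMul_map_iff θ)

theorem toH_restrict (x : (definedField G w).univ) :
    (restrict θ w x).toH = θ (NCPair.incl x) :=
  rfl

theorem isRestriction_restrict : IsRestriction θ (restrict θ w) := fun x =>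
  ⟨x.2.fst, (toH_restrict θ w x).symm⟩

theorem isCopy_definedField (hG : G.IsCopy (Heisenberg F)) (w : NCPair G.univ) :
    (definedField G w).IsCopy F :=
  hG.elim fun θ => ⟨(gEquiv (w.map θ)).symm.comp (restrict θ w)⟩

theorem IsRestriction.unique {θ : G.univ ≃[groupLang] Heisenberg F}
    {K : OmegaStructure fieldLang} {w : NCPair (Heisenberg F)}
    {κ κ' : K.univ ≃[fieldLang] MaltsevField w} (h : IsRestriction θ κ)
    (h' : IsRestriction θ κ') : κ = κ' := by
  ext x
  exact toH_injective ((h x).choose_spec.symm.trans (h' x).choose_spec)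

end DefinedField

section FieldMap

variable {F : Type u} [Field F] {G₁ G₂ G₃ : OmegaStructure groupLang}

/-- The isomorphism of defined fields induced by `p : G₁ ≃ G₂`, namely `p` followed by
`f_(p w₁, w₂)`, where `f` is carried from `H(F)` to `G₂` by `θ`. -/
noncomputable def fieldMap (θ : G₂.univ ≃[groupLang] Heisenberg F)
    (p : G₁.univ ≃[groupLang] G₂.univ) (w₁ : NCPair G₁.univ) (w₂ : NCPair G₂.univ) :
    (definedField G₁ w₁).univ ≃[fieldLang] (definedField G₂ w₂).univ :=
  (restrict θ w₂).symm.comp ((fEquiv _ _).comp (restrict (θ.comp p) w₁))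

variable (θ : G₂.univ ≃[groupLang] Heisenberg F) (p : G₁.univ ≃[groupLang] G₂.univ)
variable (w₁ : NCPair G₁.univ) (w₂ : NCPair G₂.univ)

theorem restrict_fieldMap (x : (definedField G₁ w₁).univ) :
    restrict θ w₂ (fieldMap θ p w₁ w₂ x) = fEquiv _ _ (restrict (θ.comp p) w₁ x) := by
  simp [fieldMap]

theorem fieldMap_refl : fieldMap θ (FirstOrder.Language.Equiv.refl groupLang G₂.univ) w₂ w₂ =
    FirstOrder.Language.Equiv.refl fieldLang (definedField G₂ w₂).univ := by
  refine FirstOrder.Language.Equiv.ext fun x => (restrict θ w₂).injective ?_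
  rw [restrict_fieldMap]
  exact DFunLike.congr_fun (fEquiv_self _) _

theorem fieldMap_comp (θ : G₃.univ ≃[groupLang] Heisenberg F) (p₁ : G₁.univ ≃[groupLang] G₂.univ)
    (p₂ : G₂.univ ≃[groupLang] G₃.univ) (w₃ : NCPair G₃.univ) :
    fieldMap θ (p₂.comp p₁) w₁ w₃ =
      (fieldMap θ p₂ w₂ w₃).comp (fieldMap (θ.comp p₂) p₁ w₁ w₂) := by
  refine FirstOrder.Language.Equiv.ext fun x => (restrict θ w₃).injective ?_
  rw [restrict_fieldMap, FirstOrder.Language.Equiv.comp_apply, restrict_fieldMap,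
    restrict_fieldMap]
  let θ₂ := θ.comp p₂
  exact DFunLike.congr_fun (fEquiv_comp (w₁.map (θ₂.comp p₁)) (w₂.map θ₂) (w₃.map θ))
    (restrict (θ₂.comp p₁) w₁ x)

theorem fieldMap_apply_eq_iff (x : (definedField G₁ w₁).univ) (y : (definedField G₂ w₂).univ) :
    fieldMap θ p w₁ w₂ x = y ↔
      IsTransfer (p w₁.1.1) (p w₁.1.2) w₂.1.1 w₂.1.2 (p (NCPair.incl x)) (NCPair.incl y) := by
  rw [← (restrict θ w₂).injective.eq_iff, restrict_fieldMap, ← toH_injective.eq_iff,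
    ← isTransfer_map_iff θ]
  refine .trans ?_ (isTransfer_iff (w₁.map (θ.comp p)) (w₂.map θ)).symm
  constructor
  · exact fun h => ⟨restrict (θ.comp p) w₁ x, rfl, h⟩
  · rintro ⟨a, ha, h⟩
    rwa [toH_injective (a₁ := a) (a₂ := restrict (θ.comp p) w₁ x) ha] at h

theorem pair_mem_graphCode_fieldMap_iff {a b : ℕ} :
    Nat.pair a b ∈ graphCode (fieldMap θ p w₁ w₂) ↔
      a ∈ w₁.centralizer ∧ b ∈ w₂.centralizer ∧ ∃ a', Nat.pair a a' ∈ graphCode p ∧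
        G₂.Holds (fun v : Fin 6 → G₂.univ => IsTransfer (v 0) (v 1) (v 2) (v 3) (v 4) (v 5))
          ![p w₁.1.1, p w₁.1.2, w₂.1.1, w₂.1.2, a', b] := by
  rw [pair_mem_graphCode]
  constructor
  · rintro ⟨ha, rfl⟩
    have h := (fieldMap_apply_eq_iff θ p w₁ w₂ ⟨a, ha⟩ _).1 rfl
    refine ⟨ha, (fieldMap θ p w₁ w₂ ⟨a, ha⟩).2, _, pair_mem_graphCode.2 ⟨ha.fst, rfl⟩, ?_, h⟩
    simp only [Fin.forall_fin_succ]
    exact ⟨(p _).2, (p _).2, w₂.1.1.2, w₂.1.2.2, (p _).2, (NCPair.incl _).2, fun j => j.elim0⟩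
  · rintro ⟨ha, hb, a', ha', h, htransfer⟩
    obtain ⟨_, rfl⟩ := pair_mem_graphCode.1 ha'
    exact ⟨ha, congrArg Subtype.val
      ((fieldMap_apply_eq_iff θ p w₁ w₂ ⟨a, ha⟩ ⟨b, hb⟩).2 htransfer)⟩

end FieldMap

section ChosenPair

theorem existsUnique_relMap_of_equiv {L : FirstOrder.Language} {M N : Type*} [L.Structure M]
    [L.Structure N] (θ : M ≃[L] N) {R : L.Relations 3} {op : N → N → N}
    (hop : ∀ a : Fin 3 → N, RelMap R a ↔ op (a 0) (a 1) = a 2) (x y : M) :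
    ∃! z, RelMap R ![x, y, z] := by
  have relMap_iff (z : M) : RelMap R ![x, y, z] ↔ op (θ x) (θ y) = θ z := by
    rw [← θ.map_rel, hop]
    rfl
  simp only [relMap_iff]
  exact ⟨θ.symm (op (θ x) (θ y)), (θ.apply_symm_apply _).symm,
    fun z hz => by rw [hz, θ.symm_apply_apply]⟩

variable {F : Type u} [Field F] {G : OmegaStructure groupLang}

theorem existsUnique_isMul (hG : G.IsCopy (Heisenberg F)) (x y : G.univ) : ∃! z, IsMul x y z :=
  hG.elim fun θ => existsUnique_relMap_of_equiv θ (op := (· * ·)) (fun _ => Iff.rfl) x y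

theorem exists_not_commutes (hG : G.IsCopy (Heisenberg F)) : ∃ x y : G.univ, ¬Commutes x y := by
  obtain ⟨θ⟩ := hG
  refine ⟨θ.symm (hElem 1 0 0), θ.symm (hElem 0 1 0), ?_⟩
  rw [← commutes_map_iff θ, commutes_iff_Delta_eq_zero]
  simp [Delta_hElem]

/-- The least code of a non-commuting pair of `G`. -/
noncomputable def ncPairCode (G : OmegaStructure groupLang) : ℕ :=
  sInf {k | G.Holds (fun v : Fin 2 → G.univ => ¬Commutes (v 0) (v 1)) ![k.unpair.1, k.unpair.2]}

theorem exists_holds_not_commutes (hG : G.IsCopy (Heisenberg F)) : ∃ k : ℕ,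
    G.Holds (fun v : Fin 2 → G.univ => ¬Commutes (v 0) (v 1)) ![k.unpair.1, k.unpair.2] := by
  obtain ⟨x, y, h⟩ := exists_not_commutes hG
  refine ⟨Nat.pair x y, ?_⟩
  rw [Nat.unpair_pair]
  exact ⟨by simp [Fin.forall_fin_two], h⟩

/-- The non-commuting pair `(u_G, v_G)` assigned to a copy `G` of a Heisenberg group. -/
noncomputable def chosenPair (G : OmegaStructure groupLang) (hG : G.IsCopy (Heisenberg F)) :
    NCPair G.univ :=
  have h := Nat.sInf_mem (exists_holds_not_commutes hG)
  ⟨(⟨(ncPairCode G).unpair.1, h.fst 0⟩, ⟨(ncPairCode G).unpair.2, h.fst 1⟩), h.snd⟩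

end ChosenPair

/-! ### Effectivity of the construction -/

section FunctionalRelations

variable {ι : Type*} {O : ι → ℕ → ℕ} {L : FirstOrder.Language.{0, 0}}

theorem trueIn_rel_cons_iff {M : OmegaStructure L} {R : L.Relations 3} {a b c : ℕ} :
    (AtomicSentence.rel R ![a, b, c]).TrueIn M ↔
      ∃ (ha : a ∈ M.univ) (hb : b ∈ M.univ) (hc : c ∈ M.univ),
        RelMap R ![(⟨a, ha⟩ : M.univ), ⟨b, hb⟩, ⟨c, hc⟩] := by
  constructor
  · rintro ⟨h, hR⟩
    refine ⟨h 0, h 1, h 2, ?_⟩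
    convert hR using 1
    ext j
    fin_cases j <;> rfl
  · rintro ⟨ha, hb, hc, hR⟩
    refine ⟨by simp [Fin.forall_fin_succ, ha, hb, hc], ?_⟩
    convert hR using 1
    ext j
    fin_cases j <;> rfl

theorem uniformlyDecidable_trueIn_rel_of_existsUnique {M : ι → OmegaStructure L}
    {R : L.Relations 3} (hR : ∀ i (x y : (M i).univ), ∃! z, RelMap R ![x, y, z])
    (hUniv : UniformlyDecidable O fun i n => n ∈ (M i).univ)
    (hTrue : UniformlyEnumerable O fun i a => (AtomicSentence.rel R a).TrueIn (M i)) :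
    UniformlyDecidable O fun i a => (AtomicSentence.rel R a).TrueIn (M i) := by
  have hargs : UniformlyComputable O fun _ (p : (ℕ × ℕ) × ℕ) => ![p.1.1, p.1.2, p.2] :=
    .pi <| .vecCons (.of_computable (Computable.fst.comp .fst)) <|
      .vecCons (.of_computable (Computable.snd.comp .fst)) <|
      .vecCons (.of_computable .snd) nofun
  have hdecidable : UniformlyDecidable O fun i (p : (ℕ × ℕ) × ℕ) =>
      (AtomicSentence.rel R ![p.1.1, p.1.2, p.2]).TrueIn (M i) := by
    refine .of_functional (hTrue.comp hargs)
      ((hUniv.comp (.of_computable .fst)).and (hUniv.comp (.of_computable .snd))) ?_ ?_ ?_ <;>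
        simp only [trueIn_rel_cons_iff]
    · exact fun i p c ⟨ha, hb, _⟩ => ⟨ha, hb⟩
    · rintro i p ⟨ha, hb⟩
      obtain ⟨c, hc, _⟩ := hR i ⟨p.1, ha⟩ ⟨p.2, hb⟩
      exact ⟨c, ha, hb, c.2, hc⟩
    · rintro i p c c' ⟨ha, hb, hc, h⟩ ⟨_, _, hc', h'⟩
      exact congrArg Subtype.val ((hR i ⟨p.1, ha⟩ ⟨p.2, hb⟩).unique h h')
  have hentry (j : Fin 3) : UniformlyComputable O fun _ (a : Fin 3 → ℕ) => a j :=
    .of_primrec (Primrec.fin_app.comp .id (.const j))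
  refine (hdecidable.comp (((hentry 0).pair (hentry 1)).pair (hentry 2))).of_iff fun i a => ?_
  rw [show ![a 0, a 1, a 2] = a by ext j; fin_cases j <;> rfl]

end FunctionalRelations

section FieldCode

variable {ι : Type*} {O : ι → ℕ → ℕ} {F : ι → Type u} [∀ i, Field (F i)]

instance : Finite (Σ n, fieldLang.Relations n) :=
  .of_surjective (fun b : Bool => cond b ⟨3, FieldRel.add⟩ ⟨3, FieldRel.mul⟩) <| by
    rintro ⟨_, _ | _⟩
    exacts [⟨true, rfl⟩, ⟨false, rfl⟩]

theorem existsUnique_relMap_field {F : Type u} [Field F] {K : OmegaStructure fieldLang}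
    (hK : K.IsCopy F) (R : fieldLang.Relations 3) (x y : K.univ) : ∃! z, RelMap R ![x, y, z] := by
  obtain ⟨θ⟩ := hK
  cases R with
  | add => exact existsUnique_relMap_of_equiv θ (op := (· + ·)) (fun _ => Iff.rfl) x y
  | mul => exact existsUnique_relMap_of_equiv θ (op := (· * ·)) (fun _ => Iff.rfl) x y

theorem uniformlyComputable_structureCode_field {K : ι → OmegaStructure fieldLang}
    (hK : ∀ i, (K i).IsCopy (F i)) (hUniv : UniformlyDecidable O fun i n => n ∈ (K i).univ)
    (hTrue : ∀ R : fieldLang.Relations 3,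
      UniformlyEnumerable O fun i a => (AtomicSentence.rel R a).TrueIn (K i)) :
    UniformlyComputable O fun i => structureCode (K i) := by
  have hRel (R : fieldLang.Relations 3) :=
    uniformlyDecidable_trueIn_rel_of_existsUnique (fun i => existsUnique_relMap_field (hK i) R)
      hUniv (hTrue R)
  refine uniformlyComputable_structureCode hUniv fun R => ?_
  cases R with
  | add => exact hRel FieldRel.add
  | mul => exact hRel FieldRel.mul

end FieldCode

section DefinedFieldCode

variable {ι : Type*} {O : ι → ℕ → ℕ} {F : ι → Type u} [∀ i, Field (F i)]
variable {G : ι → OmegaStructure groupLang} (hG : ∀ i, (G i).IsCopy (Heisenberg (F i)))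
variable (hO : UniformlyComputable O fun i => structureCode (G i))

include hG hO

theorem uniformlyDecidable_holds_commutes {γ : Type} [Primcodable γ] {s : ι → γ → Fin 2 → ℕ}
    (hs : ∀ j, UniformlyComputable O fun i c => s i c j) : UniformlyDecidable O fun i c =>
      (G i).Holds (fun v : Fin 2 → (G i).univ => Commutes (v 0) (v 1)) (s i c) :=
  (uniformlyExistential_commutes 0 1).uniformlyDecidable
    (uniformlyExistential_not_commutes (fun i => existsUnique_isMul (hG i)) 0 1) hO hs

theorem uniformlyComputable_ncPairCode :
    UniformlyComputable O fun i (_ : Unit) => ncPairCode (G i) := by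
  have hcodes : UniformlyDecidable O fun i (k : ℕ) => (G i).Holds
      (fun v : Fin 2 → (G i).univ => ¬Commutes (v 0) (v 1)) ![k.unpair.1, k.unpair.2] :=
    UniformlyExistential.uniformlyDecidable
      (uniformlyExistential_not_commutes (fun i => existsUnique_isMul (hG i)) 0 1)
      (by simpa only [not_not] using uniformlyExistential_commutes 0 1) hO <|
      .vecCons (.of_primrec (Primrec.fst.comp .unpair)) <|
      .vecCons (.of_primrec (Primrec.snd.comp .unpair)) nofun
  exact .sInf (P := fun i (p : Unit × ℕ) => (G i).Holds
      (fun v : Fin 2 → (G i).univ => ¬Commutes (v 0) (v 1)) ![p.2.unpair.1, p.2.unpair.2])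
    (hcodes.comp (.of_computable .snd)) fun i _ => exists_holds_not_commutes (hG i)

theorem uniformlyComputable_chosenPair_fst :
    UniformlyComputable O fun i (_ : Unit) => ((chosenPair (G i) (hG i)).1.1 : ℕ) :=
  (UniformlyComputable.of_primrec (Primrec.fst.comp .unpair)).comp
    (uniformlyComputable_ncPairCode hG hO)

theorem uniformlyComputable_chosenPair_snd :
    UniformlyComputable O fun i (_ : Unit) => ((chosenPair (G i) (hG i)).1.2 : ℕ) :=
  (UniformlyComputable.of_primrec (Primrec.snd.comp .unpair)).comp
    (uniformlyComputable_ncPairCode hG hO)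

variable {w : ∀ i, NCPair (G i).univ}
variable (hu : UniformlyComputable O fun i (_ : Unit) => ((w i).1.1 : ℕ))
variable (hv : UniformlyComputable O fun i (_ : Unit) => ((w i).1.2 : ℕ))

include hu hv

theorem uniformlyDecidable_mem_centralizer :
    UniformlyDecidable O fun i n => n ∈ (w i).centralizer := by
  have hcommutes {z : ∀ i, (G i).univ}
      (hz : UniformlyComputable O fun i (_ : Unit) => (z i : ℕ)) : UniformlyDecidable O fun i n =>
        (G i).Holds (fun v : Fin 2 → (G i).univ => Commutes (v 0) (v 1)) ![n, z i] :=
    uniformlyDecidable_holds_commutes hG hO <|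
      .vecCons (.of_computable .id) <| .vecCons (hz.comp (.of_computable (.const ()))) nofun
  refine ((hcommutes hu).and (hcommutes hv)).of_iff fun i n => ⟨?_, ?_⟩
  · exact fun ⟨h, hu, hv⟩ => ⟨⟨Fin.forall_fin_two.2 ⟨h, (w i).1.1.2⟩, hu⟩,
      Fin.forall_fin_two.2 ⟨h, (w i).1.2.2⟩, hv⟩
  · exact fun ⟨⟨h, hu⟩, _, hv⟩ => ⟨h 0, hu, hv⟩

theorem uniformlyEnumerable_trueIn_definedField (R : fieldLang.Relations 3) :
    UniformlyEnumerable O fun i a =>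
      (AtomicSentence.rel R a).TrueIn (definedField (G i) (w i)) := by
  have hentry (j : Fin 3) : UniformlyComputable O fun _ (a : Fin 3 → ℕ) => a j :=
    .of_primrec (Primrec.fin_app.comp .id (.const j))
  have hcentral : UniformlyEnumerable O fun i (a : Fin 3 → ℕ) => ∀ j, a j ∈ (w i).centralizer :=
    .of_uniformlyDecidable <| .forall_of_finite fun j =>
      (uniformlyDecidable_mem_centralizer hG hO hu hv).comp (hentry j)
  cases R with
  | add =>
    refine (hcentral.and ((uniformlyExistential_isMul (0 : Fin 3) 1 2).uniformlyEnumerable hO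
      hentry)).of_iff fun i a => ?_
    exact ⟨fun ⟨h, hR⟩ => ⟨h, fun j => (h j).fst, hR⟩, fun ⟨h, _, hR⟩ => ⟨h, hR⟩⟩
  | mul =>
    have hpair {f : ι → Unit → ℕ} (hf : UniformlyComputable O f) :
        UniformlyComputable O fun i (_ : Fin 3 → ℕ) => f i () :=
      hf.comp (.of_computable (.const ()))
    have hmul := (uniformlyExistential_isMaltsevMul (0 : Fin 5) 1 2 3 4).uniformlyEnumerable hO <|
      .vecCons (hpair hu) (.vecCons (hpair hv) hentry)
    refine (hcentral.and hmul).of_iff fun i a => ?_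
    refine ⟨fun ⟨h, hR⟩ => ⟨h, ?_, hR⟩, fun ⟨h, _, hR⟩ => ⟨h, hR⟩⟩
    exact Fin.cases (w i).1.1.2 (Fin.cases (w i).1.2.2 fun j => (h j).fst)

theorem uniformlyComputable_structureCode_definedField :
    UniformlyComputable O fun i => structureCode (definedField (G i) (w i)) :=
  uniformlyComputable_structureCode_field (fun i => isCopy_definedField (hG i) (w i))
    (uniformlyDecidable_mem_centralizer hG hO hu hv)
    (uniformlyEnumerable_trueIn_definedField hG hO hu hv)

end DefinedFieldCode

section FieldMapCode

variable {ι : Type*} {O : ι → ℕ → ℕ}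

theorem sInf_pair_mem_graphCode {X Y : Set ℕ} (p : X → Y) (x : X) :
    sInf {n | Nat.pair x n ∈ graphCode p} = p x := by
  simp [pair_mem_graphCode]

theorem uniformlyComputable_apply {X Y : ι → Set ℕ} {p : ∀ i, X i → Y i} {x : ∀ i, X i}
    (hp : UniformlyComputable O fun i => charFun (graphCode (p i)))
    (hx : UniformlyComputable O fun i (_ : Unit) => (x i : ℕ)) :
    UniformlyComputable O fun i (_ : Unit) => (p i (x i) : ℕ) := by
  simp only [← sInf_pair_mem_graphCode]
  refine .sInf (P := fun i (q : Unit × ℕ) => Nat.pair (x i) q.2 ∈ graphCode (p i)) ?_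
    fun i _ => ⟨p i (x i), x i, rfl⟩
  exact (UniformlyDecidable.of_charFun hp).comp <|
    (UniformlyComputable.of_primrec Primrec₂.natPair).comp <|
      (hx.comp (.of_computable .fst)).pair (.of_computable .snd)

variable {F : ι → Type u} [∀ i, Field (F i)] {G₁ G₂ : ι → OmegaStructure groupLang}
variable (θ : ∀ i, (G₂ i).univ ≃[groupLang] Heisenberg (F i))
variable (p : ∀ i, (G₁ i).univ ≃[groupLang] (G₂ i).univ)

theorem uniformlyComputable_mapCode_fieldMap
    (hO₁ : UniformlyComputable O fun i => structureCode (G₁ i))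
    (hO₂ : UniformlyComputable O fun i => structureCode (G₂ i))
    (hp : UniformlyComputable O fun i => mapCode (p i))
    {w₁ : ∀ i, NCPair (G₁ i).univ} {w₂ : ∀ i, NCPair (G₂ i).univ}
    (hu₁ : UniformlyComputable O fun i (_ : Unit) => ((w₁ i).1.1 : ℕ))
    (hv₁ : UniformlyComputable O fun i (_ : Unit) => ((w₁ i).1.2 : ℕ))
    (hu₂ : UniformlyComputable O fun i (_ : Unit) => ((w₂ i).1.1 : ℕ))
    (hv₂ : UniformlyComputable O fun i (_ : Unit) => ((w₂ i).1.2 : ℕ)) :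
    UniformlyComputable O fun i => mapCode (fieldMap (θ i) (p i) (w₁ i) (w₂ i)) := by
  have hcentral₁ := uniformlyDecidable_mem_centralizer (fun i => ⟨(θ i).comp (p i)⟩) hO₁ hu₁ hv₁
  have hcentral₂ := uniformlyDecidable_mem_centralizer (fun i => ⟨θ i⟩) hO₂ hu₂ hv₂
  refine uniformlyComputable_charFun_graphCode hcentral₁ ?_
  simp only [pair_mem_graphCode_fieldMap_iff]
  have hconst {f : ι → Unit → ℕ} (hf : UniformlyComputable O f) :
      UniformlyComputable O fun i (_ : (ℕ × ℕ) × ℕ) => f i () :=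
    hf.comp (.of_computable (.const ()))
  refine .and (.of_uniformlyDecidable (hcentral₁.comp (.of_computable .fst))) <|
    .and (.of_uniformlyDecidable (hcentral₂.comp (.of_computable .snd))) <|
    .exists_nat (P := fun i (q : (ℕ × ℕ) × ℕ) => Nat.pair q.1.1 q.2 ∈ graphCode (p i) ∧
      (G₂ i).Holds (fun v : Fin 6 → (G₂ i).univ => IsTransfer (v 0) (v 1) (v 2) (v 3) (v 4) (v 5))
        ![p i (w₁ i).1.1, p i (w₁ i).1.2, (w₂ i).1.1, (w₂ i).1.2, q.2, q.1.2]) <|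
    .and (.of_uniformlyDecidable ((UniformlyDecidable.of_charFun hp).comp ?_)) ?_
  · exact .of_primrec (Primrec₂.natPair.comp (Primrec.fst.comp .fst) .snd)
  · exact (uniformlyExistential_isTransfer 0 1 2 3 4 5).uniformlyEnumerable hO₂ <|
      .vecCons (hconst (uniformlyComputable_apply hp hu₁)) <|
      .vecCons (hconst (uniformlyComputable_apply hp hv₁)) <|
      .vecCons (hconst hu₂) <| .vecCons (hconst hv₂) <|
      .vecCons (.of_computable .snd) <| .vecCons (.of_computable (Computable.snd.comp .fst)) nofun

end FieldMapCode

/-! ### The computable functor -/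

section Oracles

variable {ι : Type*} (A B C : ι → ℕ → ℕ)

theorem uniformlyComputable_join₃_fst :
    UniformlyComputable (fun i => join₃ (A i) (B i) (C i)) A := by
  convert UniformlyComputable.oracle.comp (.of_primrec (Primrec.nat_mul.comp (.const 3) .id))
    using 3 with i n
  simp [join₃]

theorem uniformlyComputable_join₃_snd :
    UniformlyComputable (fun i => join₃ (A i) (B i) (C i)) B := by
  convert UniformlyComputable.oracle.comp (.of_primrec
    (Primrec.nat_add.comp (Primrec.nat_mul.comp (.const 3) .id) (.const 1))) using 3 with i n
  simp [join₃, Nat.add_mod, Nat.mul_add_div]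

theorem uniformlyComputable_join₃_thd :
    UniformlyComputable (fun i => join₃ (A i) (B i) (C i)) C := by
  convert UniformlyComputable.oracle.comp (.of_primrec
    (Primrec.nat_add.comp (Primrec.nat_mul.comp (.const 3) .id) (.const 2))) using 3 with i n
  simp [join₃, Nat.add_mod, Nat.mul_add_div]

end Oracles

section Functor

variable {F : Type u} [Field F] {G G₁ G₂ G₃ : OmegaStructure groupLang}

/-- The field `Φ(G)`. -/
noncomputable def functorObj (G : OmegaStructure groupLang) (hG : G.IsCopy (Heisenberg F)) :
    OmegaStructure fieldLang :=
  definedField G (chosenPair G hG)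

/-- The isomorphism `Ψ(G₁, p, G₂)`, for any isomorphism `θ` from `G₂` onto `H(F)`. -/
noncomputable def functorMap (θ : G₂.univ ≃[groupLang] Heisenberg F)
    (p : G₁.univ ≃[groupLang] G₂.univ) :
    (functorObj G₁ ⟨θ.comp p⟩).univ ≃[fieldLang] (functorObj G₂ ⟨θ⟩).univ :=
  fieldMap θ p (chosenPair G₁ ⟨θ.comp p⟩) (chosenPair G₂ ⟨θ⟩)

/-- A copy of the Heisenberg group over some field. All fields are covered by one index type, so
that a uniformly computable family over it is computed by one operator for all fields. -/
structure HeisenbergCopy where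
  {F : Type u}
  [field : Field F]
  G : OmegaStructure groupLang
  isCopy : G.IsCopy (Heisenberg F)

/-- An isomorphism `p` between two copies of the Heisenberg group over some field, with an
isomorphism `θ` from the second copy onto that group. -/
structure HeisenbergCopyIso where
  {F : Type u}
  [field : Field F]
  {G₁ G₂ : OmegaStructure groupLang}
  θ : G₂.univ ≃[groupLang] Heisenberg F
  p : G₁.univ ≃[groupLang] G₂.univ

attribute [instance] HeisenbergCopy.field HeisenbergCopyIso.field

theorem uniformlyComputable_functorObj : UniformlyComputable
    (fun i : HeisenbergCopy.{u} => structureCode i.G)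
    fun i => structureCode (functorObj i.G i.isCopy) :=
  uniformlyComputable_structureCode_definedField HeisenbergCopy.isCopy .oracle
    (uniformlyComputable_chosenPair_fst HeisenbergCopy.isCopy .oracle)
    (uniformlyComputable_chosenPair_snd HeisenbergCopy.isCopy .oracle)

theorem uniformlyComputable_functorMap : UniformlyComputable
    (fun i : HeisenbergCopyIso.{u} => tripleCode i.p) fun i => mapCode (functorMap i.θ i.p) := by
  have h₁ := uniformlyComputable_join₃_fst (fun i : HeisenbergCopyIso.{u} => structureCode i.G₁)
    (fun i => mapCode i.p) fun i => structureCode i.G₂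
  have h₂ := uniformlyComputable_join₃_thd (fun i : HeisenbergCopyIso.{u} => structureCode i.G₁)
    (fun i => mapCode i.p) fun i => structureCode i.G₂
  exact uniformlyComputable_mapCode_fieldMap _ _ h₁ h₂ (uniformlyComputable_join₃_snd _ _ _)
    (uniformlyComputable_chosenPair_fst _ h₁) (uniformlyComputable_chosenPair_snd _ h₁)
    (uniformlyComputable_chosenPair_fst _ h₂) (uniformlyComputable_chosenPair_snd _ h₂)

theorem exists_takes_functorObj : ∃ Φ : TuringOperator, ∀ {F : Type u} [Field F]
    (G : OmegaStructure groupLang) (hG : G.IsCopy (Heisenberg F)),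
      Φ.Takes (structureCode G) (structureCode (functorObj G hG)) :=
  uniformlyComputable_functorObj.imp fun _ hΦ _ _ G hG => hΦ ⟨G, hG⟩

theorem exists_takes_functorMap : ∃ Ψ : TuringOperator, ∀ {F : Type u} [Field F]
    {G₁ G₂ : OmegaStructure groupLang} (θ : G₂.univ ≃[groupLang] Heisenberg F)
    (p : G₁.univ ≃[groupLang] G₂.univ), Ψ.Takes (tripleCode p) (mapCode (functorMap θ p)) :=
  uniformlyComputable_functorMap.imp fun _ hΨ _ _ _ _ θ p => hΨ ⟨θ, p⟩

theorem exists_isExistential_isTransfer : ∃ ψ : groupLang.Formula (Fin 6), ψ.IsExistential ∧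
    ∀ {M : Type u} [groupLang.Structure M] (s : Fin 6 → M),
      ψ.Realize s ↔ IsTransfer (s 0) (s 1) (s 2) (s 3) (s 4) (s 5) := by
  let _ (i : Σ M : Type u, groupLang.Structure M) : groupLang.Structure i.1 := i.2
  obtain ⟨ψ, hψ, hψ_iff⟩ := (uniformlyExistential_isTransfer
    (M := fun i : Σ M : Type u, groupLang.Structure M => i.1)
    (0 : Fin 6) 1 2 3 4 5).exists_isExistential
  exact ⟨ψ, hψ, fun {M} _ => hψ_iff ⟨M, inferInstance⟩⟩

variable {Φ Ψ : TuringOperator}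

theorem eq_functorObj_of_takes
    (hΦ : ∀ G (hG : G.IsCopy (Heisenberg F)),
      Φ.Takes (structureCode G) (structureCode (functorObj G hG)))
    (hG : G.IsCopy (Heisenberg F)) {K : OmegaStructure fieldLang}
    (hK : Φ.Takes (structureCode G) (structureCode K)) : K = functorObj G hG :=
  structureCode_injective (hK.unique (hΦ G hG))

theorem isComputableFunctor
    (hΦ : ∀ G (hG : G.IsCopy (Heisenberg F)),
      Φ.Takes (structureCode G) (structureCode (functorObj G hG)))
    (hΨ : ∀ {G₁ G₂ : OmegaStructure groupLang} (θ : G₂.univ ≃[groupLang] Heisenberg F)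
      (p : G₁.univ ≃[groupLang] G₂.univ), Ψ.Takes (tripleCode p) (mapCode (functorMap θ p))) :
    IsComputableFunctor groupLang fieldLang Φ Ψ (Heisenberg F) F where
  obj G hG := ⟨functorObj G hG, isCopy_definedField hG _, hΦ G hG⟩
  map G₁ G₂ K₁ K₂ h₁ h₂ hK₁ hK₂ p := by
    obtain rfl := eq_functorObj_of_takes hΦ h₁ hK₁
    obtain rfl := eq_functorObj_of_takes hΦ h₂ hK₂
    obtain ⟨θ⟩ := h₂
    exact ⟨functorMap θ p, hΨ θ p⟩
  map_id G K hG hK := by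
    obtain rfl := eq_functorObj_of_takes hΦ hG hK
    obtain ⟨θ⟩ := hG
    have h := hΨ θ (FirstOrder.Language.Equiv.refl groupLang G.univ)
    rwa [functorMap, fieldMap_refl] at h
  map_comp G₁ G₂ G₃ K₁ K₂ K₃ h₁ h₂ h₃ hK₁ hK₂ hK₃ p₁ p₂ q₁ q₂ hq₁ hq₂ := by
    obtain rfl := eq_functorObj_of_takes hΦ h₁ hK₁
    obtain rfl := eq_functorObj_of_takes hΦ h₂ hK₂
    obtain rfl := eq_functorObj_of_takes hΦ h₃ hK₃
    obtain ⟨θ⟩ := h₃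
    obtain rfl := mapCode_injective (hq₁.unique (hΨ (θ.comp p₂) p₁))
    obtain rfl := mapCode_injective (hq₂.unique (hΨ θ p₂))
    have h := hΨ θ (p₂.comp p₁)
    rwa [functorMap, fieldMap_comp _ (chosenPair G₂ h₂)] at h

theorem map_functorMap_eq_fEquiv (θ : G₂.univ ≃[groupLang] Heisenberg F)
    (p : G₁.univ ≃[groupLang] G₂.univ)
    {κ₁ : (functorObj G₁ ⟨θ.comp p⟩).univ ≃[fieldLang]
      MaltsevField ((chosenPair G₁ ⟨θ.comp p⟩).map (θ.comp p))}
    {κ₂ : (functorObj G₂ ⟨θ⟩).univ ≃[fieldLang] MaltsevField ((chosenPair G₂ ⟨θ⟩).map θ)}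
    (hκ₁ : IsRestriction (θ.comp p) κ₁) (hκ₂ : IsRestriction θ κ₂)
    (x : (functorObj G₁ ⟨θ.comp p⟩).univ) : κ₂ (functorMap θ p x) = fEquiv _ _ (κ₁ x) := by
  obtain rfl := hκ₁.unique (isRestriction_restrict _ _)
  obtain rfl := hκ₂.unique (isRestriction_restrict _ _)
  exact restrict_fieldMap _ _ _ _ x

end Functor

end HeisenbergFunctor

theorem mainTheorem7 :
    ∃ (Φ Ψ : TuringOperator) (ψ : groupLang.Formula (Fin 6)),
      ψ.IsExistential ∧
      ∀ (F : Type u) [Field F],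
        IsComputableFunctor groupLang fieldLang Φ Ψ (Heisenberg F) F ∧
        ∃ f : ∀ w w' : NCPair (Heisenberg F), MaltsevField w ≃[fieldLang] MaltsevField w',
          -- `f_(w,w')` is the isomorphism `g_w' ∘ g_w⁻¹`, and this family is functorial
          (∀ w w' α, f w w' (gMap w α) = gMap w' α) ∧
          (∀ w, f w w = FirstOrder.Language.Equiv.refl fieldLang (MaltsevField w)) ∧
          (∀ w w' w'', f w w'' = (f w' w'').comp (f w w')) ∧
          -- `ψ` defines `f_(w,w')` in `H(F)`
          (∀ (w w' : NCPair (Heisenberg F)) (x y : Heisenberg F),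
            ψ.Realize ![w.1.1, w.1.2, w'.1.1, w'.1.2, x, y] ↔
              ∃ a : MaltsevField w, a.toH = x ∧ (f w w' a).toH = y) ∧
          -- with suitable non-commuting pairs `c G`, the field `Φ(G)` is the one defined in `G`
          -- from `c G`, and `Ψ(G₁, p, G₂)` is `p` followed by `f_(p(c G₁), c G₂)`
          ∃ c : ∀ G : OmegaStructure groupLang, G.IsCopy (Heisenberg F) → NCPair G.univ,
            (∀ (G : OmegaStructure groupLang) (hG : G.IsCopy (Heisenberg F))
                (K : OmegaStructure fieldLang), Φ.Takes (structureCode G) (structureCode K) →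
              ∀ θ : G.univ ≃[groupLang] Heisenberg F,
                ∃ κ : K.univ ≃[fieldLang] MaltsevField ((c G hG).map θ), IsRestriction θ κ) ∧
            (∀ (G₁ G₂ : OmegaStructure groupLang) (h₁ : G₁.IsCopy (Heisenberg F))
                (h₂ : G₂.IsCopy (Heisenberg F)) (K₁ K₂ : OmegaStructure fieldLang),
              Φ.Takes (structureCode G₁) (structureCode K₁) →
              Φ.Takes (structureCode G₂) (structureCode K₂) →
              ∀ (p : G₁.univ ≃[groupLang] G₂.univ) (q : K₁.univ ≃[fieldLang] K₂.univ),
                Ψ.Takes (tripleCode p) (mapCode q) →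
                ∀ (θ : G₂.univ ≃[groupLang] Heisenberg F)
                  (κ₁ : K₁.univ ≃[fieldLang] MaltsevField ((c G₁ h₁).map (θ.comp p)))
                  (κ₂ : K₂.univ ≃[fieldLang] MaltsevField ((c G₂ h₂).map θ)),
                  IsRestriction (θ.comp p) κ₁ → IsRestriction θ κ₂ →
                  ∀ x : K₁.univ, κ₂ (q x) = f _ _ (κ₁ x)) := by
  obtain ⟨Φ, hΦ⟩ := exists_takes_functorObj
  obtain ⟨Ψ, hΨ⟩ := exists_takes_functorMap
  obtain ⟨ψ, hψ, hψ_iff⟩ := exists_isExistential_isTransfer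
  refine ⟨Φ, Ψ, ψ, hψ, fun F _ => ⟨isComputableFunctor hΦ hΨ, fEquiv, fEquiv_gMap, fEquiv_self,
    fEquiv_comp, fun w w' x y => (hψ_iff _).trans (isTransfer_iff w w'), chosenPair, ?_, ?_⟩⟩
  · intro G hG K hK θ
    obtain rfl := eq_functorObj_of_takes hΦ hG hK
    exact ⟨restrict θ _, isRestriction_restrict θ _⟩
  · intro G₁ G₂ h₁ h₂ K₁ K₂ hK₁ hK₂ p q hq θ κ₁ κ₂ hκ₁ hκ₂ x
    obtain rfl := eq_functorObj_of_takes hΦ h₁ hK₁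
    obtain rfl := eq_functorObj_of_takes hΦ h₂ hK₂
    obtain rfl := mapCode_injective (hq.unique (hΨ θ p))
    exact map_functorMap_eq_fEquiv θ p hκ₁ hκ₂ x
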